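/- **Setting.** Simple types are built from a set of atomic types with $\to$. The order of an atomic type is $1$ and the order of $A\to B$ is $\max(\mathrm{ord}(A)+1,\mathrm{ord}(B))$. In the simply typed $\lambda$-calculus with de Bruijn indices and typed metavariables (unification variables, infinitely many of each type), let $a,b$ be terms of the same type in a context $\Gamma$. A *solution* of the problem $a=b$ is a type-preserving substitution $\theta$ of metavariables by terms of the context $\Gamma$ (which may contain metavariables) with $\theta a=_{\beta\eta}\theta b$, where $\theta X$ is lifted when it is put below abstractions. The problem is *second order* if all types in $\Gamma$ have order at most $2$, the common type of $a$ and $b$ is atomic, and all metavariables of $a$ and $b$ have a type of order at most $2$. The typed $\lambda\sigma$-calculus has terms $1$, $X$, $(a\,b)$, $\lambda_A a$, $a[s]$ and substitutions $\mathrm{id}$, $\uparrow$, $a.s$, $s\circ t$; each metavariable $X$ has a sort $(\Gamma,A)$, meaning $\Gamma\vdash X:A$, with infinitely many metavariables of each sort. The system $\sigma$ consists of the rules $(a\,b)[s]\to(a[s]\;b[s])$, $(\lambda a)[s]\to\lambda(a[1.(s\circ\uparrow)])$, $(a[s])[t]\to a[s\circ t]$, $1[a.s]\to a$, $a[\mathrm{id}]\to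 a$, $(s_1\circ s_2)\circ s_3\to s_1\circ(s_2\circ s_3)$, $(a.s)\circ t\to a[t].(s\circ t)$, $\mathrm{id}\circ s\to s$, $s\circ\mathrm{id}\to s$, $\uparrow\circ(a.s)\to s$, $1.\uparrow\;\to\mathrm{id}$, $1[s].(\uparrow\circ s)\to s$; the system $\lambda\sigma$ has in addition $(\lambda a)\,b\to a[b.\mathrm{id}]$ and $\lambda(a\,1)\to b$ whenever $a=_\sigma b[\uparrow]$. Substitutions of metavariables in $\lambda\sigma$ are sort-preserving and are applied by grafting (replacement without lifting). A *solution for $\sigma$ alone* of a problem $c=d$ between $\lambda\sigma$-terms of the same sort is such a substitution $\theta$ with $\theta c=_\sigma\theta d$. For a $\lambda$-term $a$ in the context $\Gamma$, the precooked term $a_F$ is the $\lambda\sigma$-term obtained by replacing each index $n+1$ by $1[\uparrow^n]$ and each occurrence of a metavariable $X$ of type $A$ below $n$ abstractions by $X[\uparrow^n]$, where $X$ now has the sort $(\Gamma,A)$. **Proposition.** Let $a=b$ be a second order unification problem in the context $\Gamma$. Let $\rho$ be the substitution that maps every metavariable $X$ of sort $(\Gamma,A_1\to\cdots\to A_n\to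 B)$, $B$ atomic, occurring in $a_F$ or $b_F$ to $\lambda_{A_1}\cdots\lambda_{A_n}Y$, where $Y$ is a new metavariable of sort $(A_n.\cdots.A_1.\Gamma,\,B)$ (different $Y$ for different $X$). Then $\rho a_F$ and $\rho b_F$ have unique $\lambda\sigma$-normal forms $\tilde a$ and $\tilde b$, and $a=b$ has a solution in the $\lambda$-calculus if and only if $\tilde a=\tilde b$ has a solution for $\sigma$ alone. -/

import Mathlib

universe u

/-! ### Simple types, contexts, order -/

/-- Simple types over a set `ι` of atomic types. -/
inductive Ty (ι : Type u) : Type u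
  | base : ι → Ty ι
  | arrow : Ty ι → Ty ι → Ty ι

/-- Contexts for de Bruijn indices: the head of the list is the type of index `1`. -/
abbrev Ctx (ι : Type u) : Type u := List (Ty ι)

namespace Ty

/-- The order of a type: atomic types have order `1`, and
`A → B` has order `max (order A + 1) (order B)`. -/
def order {ι : Type u} : Ty ι → ℕ
  | base _ => 1
  | arrow A B => max (A.order + 1) B.order

/-- Being an atomic type. -/
def IsAtomic {ι : Type u} (A : Ty ι) : Prop := ∃ i, A = base i

/-- The atomic type `B` at the end of `A₁ → ⋯ → Aₙ → B`. -/
def target {ι : Type u} : Ty ι → Ty ι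
  | base i => base i
  | arrow _ B => B.target

/-- The context obtained from `Γ` by going below the `n` abstractions of a term
`λ ⋯ λ c` of type `A₁ → ⋯ → Aₙ → B` with `B` atomic, that is, `Aₙ. ⋯ .A₁.Γ`. -/
def bodyCtx {ι : Type u} : Ty ι → Ctx ι → Ctx ι
  | base _, Γ => Γ
  | arrow A B, Γ => B.bodyCtx (A :: Γ)

end Ty

/-- `Depth Γ Θ`: the context `Θ` is `Γ` extended by finitely many variables on top; an
element is the (typed) number of these variables. -/
inductive Depth {ι : Type u} (Γ : Ctx ι) : Ctx ι → Type u
  | zero : Depth Γ Γ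
  | succ {Θ : Ctx ι} {A : Ty ι} : Depth Γ Θ → Depth Γ (A :: Θ)

/-! ### The simply typed λ-calculus with de Bruijn indices and metavariables -/

/-- De Bruijn indices of type `A` in the context `Γ`. -/
inductive Var {ι : Type u} : Ctx ι → Ty ι → Type u
  | zero {Γ : Ctx ι} {A : Ty ι} : Var (A :: Γ) A
  | succ {Γ : Ctx ι} {A B : Ty ι} : Var Γ A → Var (B :: Γ) A

/-- Well-typed λ-terms. A metavariable (a unification variable) is a type together with a
name; it may occur below any number of abstractions. -/
inductive Lam {ι : Type u} : Ctx ι → Ty ι → Type u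
  | var {Γ : Ctx ι} {A : Ty ι} : Var Γ A → Lam Γ A
  | mvar {Γ : Ctx ι} (A : Ty ι) (n : ℕ) : Lam Γ A
  | app {Γ : Ctx ι} {A B : Ty ι} : Lam Γ (.arrow A B) → Lam Γ A → Lam Γ B
  | lam {Γ : Ctx ι} {A B : Ty ι} : Lam (A :: Γ) B → Lam Γ (.arrow A B)

namespace Lam

variable {ι : Type u}

/-- The renaming `ρ` below an abstraction. -/
def liftRen {Γ Δ : Ctx ι} (ρ : ∀ A, Var Γ A → Var Δ A) (B : Ty ι) :
    ∀ A, Var (B :: Γ) A → Var (B :: Δ) A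
  | _, .zero => .zero
  | _, .succ v => .succ (ρ _ v)

/-- Renaming of de Bruijn indices; metavariables are left alone. -/
def ren {Γ Δ : Ctx ι} (ρ : ∀ A, Var Γ A → Var Δ A) {A : Ty ι} : Lam Γ A → Lam Δ A
  | var v => var (ρ _ v)
  | mvar A n => mvar A n
  | app a b => app (ren ρ a) (ren ρ b)
  | lam a => lam (ren (liftRen ρ _) a)

/-- The lifting `a⁺`: every free index is incremented. -/
def shift {Γ : Ctx ι} {A B : Ty ι} (a : Lam Γ A) : Lam (B :: Γ) A :=
  ren (fun _ v => .succ v) a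

/-- The substitution `τ` below an abstraction. -/
def liftSub {Γ Δ : Ctx ι} (τ : ∀ A, Var Γ A → Lam Δ A) (B : Ty ι) :
    ∀ A, Var (B :: Γ) A → Lam (B :: Δ) A
  | _, .zero => var .zero
  | _, .succ v => shift (τ _ v)

/-- Simultaneous capture-avoiding substitution of de Bruijn indices; metavariables are left
alone. -/
def sub {Γ Δ : Ctx ι} (τ : ∀ A, Var Γ A → Lam Δ A) {A : Ty ι} : Lam Γ A → Lam Δ A
  | var v => τ _ v
  | mvar A n => mvar A n
  | app a b => app (sub τ a) (sub τ b)
  | lam a => lam (sub (liftSub τ _) a)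

/-- The substitution `1 ↦ b`, `k + 1 ↦ k`. -/
def single {Γ : Ctx ι} {B : Ty ι} (b : Lam Γ B) : ∀ A, Var (B :: Γ) A → Lam Γ A
  | _, .zero => b
  | _, .succ v => var v

/-- One step of βη-reduction. -/
inductive Step : ∀ {Γ : Ctx ι} {A : Ty ι}, Lam Γ A → Lam Γ A → Prop
  | beta {Γ : Ctx ι} {A B : Ty ι} (a : Lam (A :: Γ) B) (b : Lam Γ A) :
      Step (app (lam a) b) (sub (single b) a)
  | eta {Γ : Ctx ι} {A B : Ty ι} (a : Lam Γ (.arrow A B)) :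
      Step (lam (app (shift a) (var .zero))) a
  | appL {Γ : Ctx ι} {A B : Ty ι} {a a' : Lam Γ (.arrow A B)} (b : Lam Γ A) :
      Step a a' → Step (app a b) (app a' b)
  | appR {Γ : Ctx ι} {A B : Ty ι} (a : Lam Γ (.arrow A B)) {b b' : Lam Γ A} :
      Step b b' → Step (app a b) (app a b')
  | lam {Γ : Ctx ι} {A B : Ty ι} {a a' : Lam (A :: Γ) B} :
      Step a a' → Step (lam a) (lam a')

/-- βη-equality. -/
def Conv {Γ : Ctx ι} {A : Ty ι} : Lam Γ A → Lam Γ A → Prop := Relation.EqvGen Step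

/-- Lifting of a term as many times as the depth says. -/
def shiftBy {Γ Θ : Ctx ι} {A : Ty ι} (a : Lam Γ A) : Depth Γ Θ → Lam Θ A
  | .zero => a
  | .succ d => shift (shiftBy a d)

/-- Capture-avoiding substitution of metavariables by terms of the context `Γ`: an occurrence
of `X` below `d` abstractions is replaced by `θ X` lifted `d` times. -/
def instAt {Γ : Ctx ι} (θ : ∀ A : Ty ι, ℕ → Lam Γ A) {Θ : Ctx ι} {A : Ty ι} :
    Depth Γ Θ → Lam Θ A → Lam Θ A
  | _, var v => var v
  | d, mvar A n => shiftBy (θ A n) d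
  | d, app a b => app (instAt θ d a) (instAt θ d b)
  | d, lam a => lam (instAt θ d.succ a)

/-- The term `θ a`, for a term `a` of the context `Γ`. -/
def inst {Γ : Ctx ι} {A : Ty ι} (θ : ∀ A : Ty ι, ℕ → Lam Γ A) (a : Lam Γ A) : Lam Γ A :=
  instAt θ .zero a

/-- The metavariables of a term. -/
def mvars {Γ : Ctx ι} {A : Ty ι} : Lam Γ A → Set (Ty ι × ℕ)
  | var _ => ∅
  | mvar A n => {(A, n)}
  | app a b => mvars a ∪ mvars b
  | lam a => mvars a

/-- The unification problem `a = b` has a solution in the λ-calculus. -/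
def HasSolution {Γ : Ctx ι} {A : Ty ι} (a b : Lam Γ A) : Prop :=
  ∃ θ : ∀ A : Ty ι, ℕ → Lam Γ A, Conv (inst θ a) (inst θ b)

/-- The unification problem `a = b` is a second order unification problem. -/
structure IsSecondOrder {Γ : Ctx ι} {A : Ty ι} (a b : Lam Γ A) : Prop where
  ctx : ∀ B ∈ Γ, B.order ≤ 2
  atomic : A.IsAtomic
  mvars : ∀ X ∈ mvars a ∪ mvars b, X.1.order ≤ 2

end Lam

/-! ### The typed λσ-calculus -/

/-- The two kinds of λσ-expressions: terms `Γ ⊢ a : A` and substitutions `Γ ⊢ s ▷ Δ`. -/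
inductive Kind (ι : Type u) : Type u
  | tm : Ctx ι → Ty ι → Kind ι
  | sb : Ctx ι → Ctx ι → Kind ι

/-- Well-typed λσ-expressions. A metavariable is a sort `(Γ, A)` together with a name; there
are no substitution metavariables. -/
inductive Exp {ι : Type u} : Kind ι → Type u
  /-- The index `1`. -/
  | one {Γ : Ctx ι} {A : Ty ι} : Exp (.tm (A :: Γ) A)
  /-- The metavariable of sort `(Γ, A)` with name `n`. -/
  | mvar (Γ : Ctx ι) (A : Ty ι) (n : ℕ) : Exp (.tm Γ A)
  /-- Application `(a b)`. -/
  | app {Γ : Ctx ι} {A B : Ty ι} :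
      Exp (.tm Γ (.arrow A B)) → Exp (.tm Γ A) → Exp (.tm Γ B)
  /-- Abstraction `λ_A a`. -/
  | lam {Γ : Ctx ι} {A B : Ty ι} : Exp (.tm (A :: Γ) B) → Exp (.tm Γ (.arrow A B))
  /-- Closure `a[s]`. -/
  | clos {Γ Δ : Ctx ι} {A : Ty ι} : Exp (.tm Δ A) → Exp (.sb Γ Δ) → Exp (.tm Γ A)
  /-- The identity substitution `id`. -/
  | id {Γ : Ctx ι} : Exp (.sb Γ Γ)
  /-- The shift `↑`. -/
  | shift {Γ : Ctx ι} {A : Ty ι} : Exp (.sb (A :: Γ) Γ)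
  /-- The substitution `a.s`. -/
  | cons {Γ Δ : Ctx ι} {A : Ty ι} :
      Exp (.tm Γ A) → Exp (.sb Γ Δ) → Exp (.sb Γ (A :: Δ))
  /-- Composition `s ∘ t` (first `s`, then `t`). -/
  | comp {Γ Δ Θ : Ctx ι} : Exp (.sb Δ Θ) → Exp (.sb Γ Δ) → Exp (.sb Γ Θ)

namespace Exp

variable {ι : Type u}

/-- The rules of `σ`, at the root of an expression. -/
inductive SigmaRule : ∀ {k : Kind ι}, Exp k → Exp k → Prop
  /-- `(a b)[s] → (a[s] b[s])` -/
  | app {Γ Δ : Ctx ι} {A B : Ty ι} (a : Exp (.tm Δ (.arrow A B))) (b : Exp (.tm Δ A))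
      (s : Exp (.sb Γ Δ)) :
      SigmaRule (clos (app a b) s) (app (clos a s) (clos b s))
  /-- `(λ a)[s] → λ (a[1.(s ∘ ↑)])` -/
  | abs {Γ Δ : Ctx ι} {A B : Ty ι} (a : Exp (.tm (A :: Δ) B)) (s : Exp (.sb Γ Δ)) :
      SigmaRule (clos (lam a) s) (lam (clos a (cons one (comp s shift))))
  /-- `a[s][t] → a[s ∘ t]` -/
  | clos {Γ Δ Θ : Ctx ι} {A : Ty ι} (a : Exp (.tm Θ A)) (s : Exp (.sb Δ Θ))
      (t : Exp (.sb Γ Δ)) :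
      SigmaRule (clos (clos a s) t) (clos a (comp s t))
  /-- `1[a.s] → a` -/
  | varCons {Γ Δ : Ctx ι} {A : Ty ι} (a : Exp (.tm Γ A)) (s : Exp (.sb Γ Δ)) :
      SigmaRule (clos one (cons a s)) a
  /-- `a[id] → a` -/
  | id {Γ : Ctx ι} {A : Ty ι} (a : Exp (.tm Γ A)) : SigmaRule (clos a id) a
  /-- `(s₁ ∘ s₂) ∘ s₃ → s₁ ∘ (s₂ ∘ s₃)` -/
  | assoc {Γ Δ Θ Ξ : Ctx ι} (s₁ : Exp (.sb Θ Ξ)) (s₂ : Exp (.sb Δ Θ))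
      (s₃ : Exp (.sb Γ Δ)) :
      SigmaRule (comp (comp s₁ s₂) s₃) (comp s₁ (comp s₂ s₃))
  /-- `(a.s) ∘ t → a[t].(s ∘ t)` -/
  | map {Γ Δ Θ : Ctx ι} {A : Ty ι} (a : Exp (.tm Δ A)) (s : Exp (.sb Δ Θ))
      (t : Exp (.sb Γ Δ)) :
      SigmaRule (comp (cons a s) t) (cons (clos a t) (comp s t))
  /-- `id ∘ s → s` -/
  | idL {Γ Δ : Ctx ι} (s : Exp (.sb Γ Δ)) : SigmaRule (comp id s) s
  /-- `s ∘ id → s` -/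
  | idR {Γ Δ : Ctx ι} (s : Exp (.sb Γ Δ)) : SigmaRule (comp s id) s
  /-- `↑ ∘ (a.s) → s` -/
  | shiftCons {Γ Δ : Ctx ι} {A : Ty ι} (a : Exp (.tm Γ A)) (s : Exp (.sb Γ Δ)) :
      SigmaRule (comp shift (cons a s)) s
  /-- `1.↑ → id` -/
  | varShift {Γ : Ctx ι} {A : Ty ι} :
      SigmaRule (cons one shift : Exp (.sb (A :: Γ) (A :: Γ))) id
  /-- `1[s].(↑ ∘ s) → s` -/
  | sCons {Γ Δ : Ctx ι} {A : Ty ι} (s : Exp (.sb Γ (A :: Δ))) :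
      SigmaRule (cons (clos one s) (comp shift s)) s

/-- Application of a rule anywhere in an expression. -/
inductive Compat (R : ∀ {k : Kind ι}, Exp k → Exp k → Prop) :
    ∀ {k : Kind ι}, Exp k → Exp k → Prop
  | root {k : Kind ι} {e e' : Exp k} : R e e' → Compat R e e'
  | appL {Γ : Ctx ι} {A B : Ty ι} {a a' : Exp (.tm Γ (.arrow A B))} (b : Exp (.tm Γ A)) :
      Compat R a a' → Compat R (app a b) (app a' b)
  | appR {Γ : Ctx ι} {A B : Ty ι} (a : Exp (.tm Γ (.arrow A B))) {b b' : Exp (.tm Γ A)} :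
      Compat R b b' → Compat R (app a b) (app a b')
  | lam {Γ : Ctx ι} {A B : Ty ι} {a a' : Exp (.tm (A :: Γ) B)} :
      Compat R a a' → Compat R (lam a) (lam a')
  | closL {Γ Δ : Ctx ι} {A : Ty ι} {a a' : Exp (.tm Δ A)} (s : Exp (.sb Γ Δ)) :
      Compat R a a' → Compat R (clos a s) (clos a' s)
  | closR {Γ Δ : Ctx ι} {A : Ty ι} (a : Exp (.tm Δ A)) {s s' : Exp (.sb Γ Δ)} :
      Compat R s s' → Compat R (clos a s) (clos a s')
  | consL {Γ Δ : Ctx ι} {A : Ty ι} {a a' : Exp (.tm Γ A)} (s : Exp (.sb Γ Δ)) :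
      Compat R a a' → Compat R (cons a s) (cons a' s)
  | consR {Γ Δ : Ctx ι} {A : Ty ι} (a : Exp (.tm Γ A)) {s s' : Exp (.sb Γ Δ)} :
      Compat R s s' → Compat R (cons a s) (cons a s')
  | compL {Γ Δ Θ : Ctx ι} {s s' : Exp (.sb Δ Θ)} (t : Exp (.sb Γ Δ)) :
      Compat R s s' → Compat R (comp s t) (comp s' t)
  | compR {Γ Δ Θ : Ctx ι} (s : Exp (.sb Δ Θ)) {t t' : Exp (.sb Γ Δ)} :
      Compat R t t' → Compat R (comp s t) (comp s t')

/-- One step of σ-reduction. -/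
def SigmaStep {k : Kind ι} : Exp k → Exp k → Prop := Compat SigmaRule

/-- Equality modulo `σ` alone. -/
def SigmaConv {k : Kind ι} : Exp k → Exp k → Prop := Relation.EqvGen SigmaStep

/-- The rules of `λσ`, at the root of an expression. -/
inductive LambdaSigmaRule : ∀ {k : Kind ι}, Exp k → Exp k → Prop
  | sigma {k : Kind ι} {e e' : Exp k} : SigmaRule e e' → LambdaSigmaRule e e'
  /-- `(λ a) b → a[b.id]` -/
  | beta {Γ : Ctx ι} {A B : Ty ι} (a : Exp (.tm (A :: Γ) B)) (b : Exp (.tm Γ A)) :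
      LambdaSigmaRule (app (lam a) b) (clos a (cons b id))
  /-- `λ (a 1) → b` if `a` and `b[↑]` are equal modulo `σ` -/
  | eta {Γ : Ctx ι} {A B : Ty ι} (a : Exp (.tm (A :: Γ) (.arrow A B)))
      (b : Exp (.tm Γ (.arrow A B))) :
      SigmaConv a (clos b shift) → LambdaSigmaRule (lam (app a one)) b

/-- One step of λσ-reduction. -/
def LambdaSigmaStep {k : Kind ι} : Exp k → Exp k → Prop := Compat LambdaSigmaRule

/-- `e'` is a λσ-normal form of `e`. -/
def IsNormalFormOf {k : Kind ι} (e' e : Exp k) : Prop :=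
  Relation.ReflTransGen LambdaSigmaStep e e' ∧ ∀ e'' : Exp k, ¬ LambdaSigmaStep e' e''

/-- Application of the substitution `θ` to an expression: metavariables are replaced without
any lifting (grafting). -/
def graft (θ : ∀ (Γ : Ctx ι) (A : Ty ι), ℕ → Exp (.tm Γ A)) : ∀ {k : Kind ι}, Exp k → Exp k
  | _, one => one
  | _, mvar Γ A n => θ Γ A n
  | _, app a b => app (graft θ a) (graft θ b)
  | _, lam a => lam (graft θ a)
  | _, clos a s => clos (graft θ a) (graft θ s)
  | _, id => id
  | _, shift => shift
  | _, cons a s => cons (graft θ a) (graft θ s)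
  | _, comp s t => comp (graft θ s) (graft θ t)

/-- The problem `a = b` has a solution modulo `σ` alone. -/
def HasSigmaSolution {Γ : Ctx ι} {A : Ty ι} (a b : Exp (.tm Γ A)) : Prop :=
  ∃ θ : ∀ (Γ : Ctx ι) (A : Ty ι), ℕ → Exp (.tm Γ A), SigmaConv (graft θ a) (graft θ b)

/-- The metavariables of an expression. -/
def mvars : ∀ {k : Kind ι}, Exp k → Set (Ctx ι × Ty ι × ℕ)
  | _, one => ∅
  | _, mvar Γ A n => {(Γ, A, n)}
  | _, app a b => mvars a ∪ mvars b
  | _, lam a => mvars a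
  | _, clos a s => mvars a ∪ mvars s
  | _, id => ∅
  | _, shift => ∅
  | _, cons a s => mvars a ∪ mvars s
  | _, comp s t => mvars s ∪ mvars t

/-! ### Precooking and the substitution `X ↦ λ ⋯ λ Y` -/

/-- The substitution `↑ⁿ`, with `↑⁰ = id` and `↑ⁿ⁺¹ = ↑ⁿ ∘ ↑`. -/
def shiftPow {Γ Θ : Ctx ι} : Depth Γ Θ → Exp (.sb Θ Γ)
  | .zero => id
  | .succ d => comp (shiftPow d) shift

end Exp

/-- The part of the context that lies below a given index. -/
def Var.rest {ι : Type u} : ∀ {Γ : Ctx ι} {A : Ty ι}, Var Γ A → Ctx ι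
  | _ :: Γ, _, .zero => Γ
  | _, _, .succ v => v.rest

/-- The number of indices before a given one: `n` for the index `n + 1`. -/
def Var.depth {ι : Type u} : ∀ {Γ : Ctx ι} {A : Ty ι} (v : Var Γ A), Depth (A :: v.rest) Γ
  | _, _, .zero => .zero
  | _, _, .succ v => .succ v.depth

namespace Lam

variable {ι : Type u}

/-- Precooking below `d` abstractions: the index `n + 1` becomes `1[↑ⁿ]`, and a metavariable
`X` of type `A` becomes `X[↑ᵈ]`, where `X` is now of sort `(Γ, A)`. -/
def precookAt {Γ : Ctx ι} : ∀ {Θ : Ctx ι} {A : Ty ι}, Depth Γ Θ → Lam Θ A → Exp (.tm Θ A)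
  | _, _, _, var v => .clos .one (Exp.shiftPow v.depth)
  | _, _, d, mvar A n => .clos (.mvar Γ A n) (Exp.shiftPow d)
  | _, _, d, app a b => .app (precookAt d a) (precookAt d b)
  | _, _, d, lam a => .lam (precookAt d.succ a)

/-- The precooking `a_F` of a term `a` of the context `Γ`. -/
def precook {Γ : Ctx ι} {A : Ty ι} (a : Lam Γ A) : Exp (.tm Γ A) := precookAt .zero a

end Lam

namespace Exp

variable {ι : Type u}

/-- The term `λ ⋯ λ Y` of sort `(Γ, A₁ → ⋯ → Aₙ → B)`, where `Y` is the metavariable of sort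
`(Aₙ. ⋯ .A₁.Γ, B)` with name `y`. -/
def lamsMVar : ∀ (A : Ty ι) (Γ : Ctx ι), ℕ → Exp (.tm Γ A)
  | .base i, Γ, y => mvar Γ (.base i) y
  | .arrow A B, Γ, y => lam (lamsMVar B (A :: Γ) y)

/-- The metavariable `Y` that is associated with `X` when the names are chosen by `ν`. -/
def newMVar (ν : Ctx ι → Ty ι → ℕ → ℕ) (X : Ctx ι × Ty ι × ℕ) : Ctx ι × Ty ι × ℕ :=
  (X.2.1.bodyCtx X.1, X.2.1.target, ν X.1 X.2.1 X.2.2)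

/-- The names chosen by `ν` are new with respect to the set `S` of metavariables: different
elements `X` of `S` get different `Y`, and no such `Y` is in `S`. -/
def IsNew (ν : Ctx ι → Ty ι → ℕ → ℕ) (S : Set (Ctx ι × Ty ι × ℕ)) : Prop :=
  Set.InjOn (newMVar ν) S ∧ ∀ X ∈ S, newMVar ν X ∉ S

/-- The result of replacing each metavariable `X` by `λ ⋯ λ Y`. -/
def expand (ν : Ctx ι → Ty ι → ℕ → ℕ) {k : Kind ι} (e : Exp k) : Exp k :=
  graft (fun Γ A n => lamsMVar A Γ (ν Γ A n)) e

end Exp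

/-! Modulo `σ`, a λσ-term is a λ-term in which each occurrence of a metavariable carries the tuple
of terms supplied by its pending substitution; these are the contextual terms `CTm`. The map `eval`
carries out all substitutions and is invariant under `σ`; `reify` picks a representative, to which
every expression with that value σ-reduces (`steps_reify_eval`). So σ-equality is equality of
values. A λσ-step becomes βη-reduction of values (`LambdaSigmaStep.eval_steps`), and a βη-step of
values lifts to λσ-reduction of representatives (`steps_reify`). On contextual terms βη is strongly
normalizing by reducibility and locally confluent, hence confluent. The representative of the
βη-normal value is therefore the unique λσ-normal form (`existsUnique_isNormalFormOf`); termination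
of λσ itself is not needed.

A σ-solution, grafted into the two normal forms, gives equal values. Grafting preserves
βη-reduction, and forgetting the tuples (`collapse`) turns contextual βη into βη on λ-terms, so the
instances of the terms `λ ⋯ λ Y` solve the original problem.

Conversely, given a λ-solution, let the value of each `Y` be the βη-normal form of the body of the
solution for `X`. The two grafted normal forms are then βη-equal, and they must be shown to be
identical. It suffices that grafting leaves them βη-normal (`graftIrredObj`). This is where the
order bound enters: in the normal forms every metavariable is atomic and its arguments are of atomic
type or variables of `Γ` (`Flat`, stable under reduction), while an applied head is a variable of
order at most two, so that its arguments are atomic. Hence only non-abstractions are substituted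
into the bodies, and such a substitution creates neither β- nor η-redexes (`irred_sub`). -/

open Relation (ReflTransGen)

/-! ### Contextual terms

Terms in which every metavariable carries an explicit tuple of terms for the variables of its
context.  Modulo `σ`, these are the λσ-expressions. -/

/-- The classifiers of contextual terms: a type, for terms, or a context, for tuples of terms. -/
inductive Obj (ι : Type u) : Type u
  | ty : Ty ι → Obj ι
  | cx : Ctx ι → Obj ι

/-- Contextual terms and tuples of contextual terms. -/
inductive CTm {ι : Type u} : Ctx ι → Obj ι → Type u
  | var {Γ : Ctx ι} {A : Ty ι} : Var Γ A → CTm Γ (.ty A)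
  | mvar {Γ : Ctx ι} (Δ : Ctx ι) (A : Ty ι) (n : ℕ) : CTm Γ (.cx Δ) → CTm Γ (.ty A)
  | app {Γ : Ctx ι} {A B : Ty ι} :
      CTm Γ (.ty (.arrow A B)) → CTm Γ (.ty A) → CTm Γ (.ty B)
  | lam {Γ : Ctx ι} {A B : Ty ι} : CTm (A :: Γ) (.ty B) → CTm Γ (.ty (.arrow A B))
  | nil {Γ : Ctx ι} : CTm Γ (.cx [])
  | cons {Γ Δ : Ctx ι} {A : Ty ι} : CTm Γ (.ty A) → CTm Γ (.cx Δ) → CTm Γ (.cx (A :: Δ))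

/-- Renamings of the variables of `Γ` by variables of `Δ`. -/
abbrev Ren {ι : Type u} (Γ Δ : Ctx ι) : Type u := ∀ A, Var Γ A → Var Δ A

/-- Substitutions of the variables of `Γ` by contextual terms over `Δ`. -/
abbrev Env {ι : Type u} (Γ Δ : Ctx ι) : Type u := ∀ A, Var Γ A → CTm Δ (.ty A)

/-- The renaming that adds one variable on top. -/
abbrev Ren.succ {ι : Type u} {Γ : Ctx ι} {B : Ty ι} : Ren Γ (B :: Γ) := fun _ v => .succ v

namespace CTm

open Lam (liftRen)

variable {ι : Type u}

/-- Renaming. -/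
def ren : ∀ {Γ Δ : Ctx ι} {o : Obj ι}, Ren Γ Δ → CTm Γ o → CTm Δ o
  | _, _, _, ρ, var v => var (ρ _ v)
  | _, _, _, ρ, mvar Θ A n s => mvar Θ A n (ren ρ s)
  | _, _, _, ρ, app a b => app (ren ρ a) (ren ρ b)
  | _, _, _, ρ, lam a => lam (ren (liftRen ρ _) a)
  | _, _, _, _, nil => nil
  | _, _, _, ρ, cons a s => cons (ren ρ a) (ren ρ s)

/-- Weakening by one variable. -/
abbrev shift {Γ : Ctx ι} {o : Obj ι} {B : Ty ι} (t : CTm Γ o) : CTm (B :: Γ) o :=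
  ren Ren.succ t

/-- The substitution `b.τ`. -/
def consEnv {Γ Δ : Ctx ι} {B : Ty ι} (b : CTm Δ (.ty B)) (τ : Env Γ Δ) : Env (B :: Γ) Δ
  | _, .zero => b
  | _, .succ v => τ _ v

/-- The substitution `τ` below an abstraction. -/
def liftEnv {Γ Δ : Ctx ι} (τ : Env Γ Δ) (B : Ty ι) : Env (B :: Γ) (B :: Δ) :=
  consEnv (var .zero) (fun _ v => shift (τ _ v))

/-- Simultaneous substitution. -/
def sub : ∀ {Γ Δ : Ctx ι} {o : Obj ι}, Env Γ Δ → CTm Γ o → CTm Δ o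
  | _, _, _, τ, var v => τ _ v
  | _, _, _, τ, mvar Θ A n s => mvar Θ A n (sub τ s)
  | _, _, _, τ, app a b => app (sub τ a) (sub τ b)
  | _, _, _, τ, lam a => lam (sub (liftEnv τ _) a)
  | _, _, _, _, nil => nil
  | _, _, _, τ, cons a s => cons (sub τ a) (sub τ s)

/-- The substitution of the last variable by `b`. -/
abbrev single {Γ : Ctx ι} {B : Ty ι} (b : CTm Γ (.ty B)) : Env (B :: Γ) Γ :=
  consEnv b (fun _ v => var v)

/-! ### The algebra of renaming and substitution. -/

theorem liftEnv_ren {Γ Δ : Ctx ι} (ρ : Ren Γ Δ) (B : Ty ι) :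
    liftEnv (fun _ v => var (ρ _ v)) B = fun _ v => var (liftRen ρ B _ v) := by
  funext A v; cases v <;> rfl

theorem ren_eq_sub {Γ Δ : Ctx ι} {o : Obj ι} (ρ : Ren Γ Δ) (t : CTm Γ o) :
    ren ρ t = sub (fun _ v => var (ρ _ v)) t := by
  induction t generalizing Δ with
  | var v => rfl
  | mvar _ _ _ s ih => simp only [ren, sub, ih]
  | app a b iha ihb => simp only [ren, sub, iha, ihb]
  | lam a ih => simp only [ren, sub, ih, liftEnv_ren]
  | nil => rfl
  | cons a s iha ihs => simp only [ren, sub, iha, ihs]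

theorem sub_var {Γ : Ctx ι} {o : Obj ι} (t : CTm Γ o) : sub (fun _ v => var v) t = t := by
  have h : ∀ (Γ : Ctx ι) (B : Ty ι),
      liftEnv (fun _ v => var v : Env Γ Γ) B = fun _ v => var v := by
    intro Γ B; funext A v; cases v <;> rfl
  induction t with
  | var v => rfl
  | mvar _ _ _ s ih => simp only [sub, ih]
  | app a b iha ihb => simp only [sub, iha, ihb]
  | lam a ih => simp only [sub, ih, h]
  | nil => rfl
  | cons a s iha ihs => simp only [sub, iha, ihs]

theorem sub_ren {Γ Δ Θ : Ctx ι} {o : Obj ι} (τ : Env Δ Θ) (ρ : Ren Γ Δ) (t : CTm Γ o) :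
    sub τ (ren ρ t) = sub (fun _ v => τ _ (ρ _ v)) t := by
  have h : ∀ {Γ Δ Θ : Ctx ι} (τ : Env Δ Θ) (ρ : Ren Γ Δ) (B : Ty ι),
      (fun A v => liftEnv τ B A (liftRen ρ B A v)) = liftEnv (fun _ v => τ _ (ρ _ v)) B := by
    intro Γ Δ Θ τ ρ B; funext A v; cases v <;> rfl
  induction t generalizing Δ Θ with
  | var v => rfl
  | mvar _ _ _ s ih => simp only [ren, sub, ih]
  | app a b iha ihb => simp only [ren, sub, iha, ihb]
  | lam a ih => simp only [ren, sub, ih, h]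
  | nil => rfl
  | cons a s iha ihs => simp only [ren, sub, iha, ihs]

theorem ren_ren {Γ Δ Θ : Ctx ι} {o : Obj ι} (σ : Ren Δ Θ) (ρ : Ren Γ Δ) (t : CTm Γ o) :
    ren σ (ren ρ t) = ren (fun _ v => σ _ (ρ _ v)) t := by
  simp only [ren_eq_sub σ, sub_ren, ← ren_eq_sub]

theorem liftEnv_ren_comp {Γ Δ Θ : Ctx ι} (ρ : Ren Δ Θ) (τ : Env Γ Δ) (B : Ty ι) :
    (fun A v => ren (liftRen ρ B) (liftEnv τ B A v)) = liftEnv (fun _ v => ren ρ (τ _ v)) B := by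
  funext A v
  cases v with
  | zero => rfl
  | succ v =>
    change ren (liftRen ρ B) (ren Ren.succ (τ A v)) = ren Ren.succ (ren ρ (τ A v))
    rw [ren_ren, ren_ren]; rfl

theorem ren_sub {Γ Δ Θ : Ctx ι} {o : Obj ι} (ρ : Ren Δ Θ) (τ : Env Γ Δ) (t : CTm Γ o) :
    ren ρ (sub τ t) = sub (fun _ v => ren ρ (τ _ v)) t := by
  induction t generalizing Δ Θ with
  | var v => rfl
  | mvar _ _ _ s ih => simp only [sub, ren, ih]
  | app a b iha ihb => simp only [sub, ren, iha, ihb]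
  | lam a ih => simp only [sub, ren, ih, liftEnv_ren_comp]
  | nil => rfl
  | cons a s iha ihs => simp only [sub, ren, iha, ihs]

theorem liftEnv_sub_comp {Γ Δ Θ : Ctx ι} (σ : Env Δ Θ) (τ : Env Γ Δ) (B : Ty ι) :
    (fun A v => sub (liftEnv σ B) (liftEnv τ B A v)) = liftEnv (fun _ v => sub σ (τ _ v)) B := by
  funext A v
  cases v with
  | zero => rfl
  | succ v =>
    change sub (liftEnv σ B) (ren Ren.succ (τ A v)) = ren Ren.succ (sub σ (τ A v))
    rw [sub_ren, ren_sub]; rfl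

/-- Going below an abstraction weakens the substituted terms, so the mixed laws `sub_ren` and
`ren_sub` have to come before this one. -/
theorem sub_sub {Γ Δ Θ : Ctx ι} {o : Obj ι} (σ : Env Δ Θ) (τ : Env Γ Δ) (t : CTm Γ o) :
    sub σ (sub τ t) = sub (fun _ v => sub σ (τ _ v)) t := by
  induction t generalizing Δ Θ with
  | var v => rfl
  | mvar _ _ _ s ih => simp only [sub, ih]
  | app a b iha ihb => simp only [sub, iha, ihb]
  | lam a ih => simp only [sub, ih, liftEnv_sub_comp]
  | nil => rfl
  | cons a s iha ihs => simp only [sub, iha, ihs]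

theorem sub_consEnv_shift {Γ Δ : Ctx ι} {o : Obj ι} {B : Ty ι} (b : CTm Δ (.ty B))
    (τ : Env Γ Δ) (t : CTm Γ o) : sub (consEnv b τ) (shift t) = sub τ t := sub_ren _ _ _

theorem sub_single_shift {Γ : Ctx ι} {o : Obj ι} {B : Ty ι} (b : CTm Γ (.ty B))
    (t : CTm Γ o) : sub (single b) (shift t) = t := by
  rw [sub_consEnv_shift, sub_var]

theorem sub_single_liftEnv {Γ Δ : Ctx ι} {o : Obj ι} {B : Ty ι} (b : CTm Δ (.ty B))
    (τ : Env Γ Δ) (t : CTm (B :: Γ) o) :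
    sub (single b) (sub (liftEnv τ B) t) = sub (consEnv b τ) t := by
  rw [sub_sub]; congr 1; funext A v
  cases v
  · rfl
  · exact sub_single_shift _ _

theorem sub_sub_single {Γ Δ : Ctx ι} {o : Obj ι} {B : Ty ι} (b : CTm Γ (.ty B))
    (τ : Env Γ Δ) (t : CTm (B :: Γ) o) :
    sub τ (sub (single b) t) = sub (single (sub τ b)) (sub (liftEnv τ B) t) := by
  rw [sub_single_liftEnv, sub_sub]; congr 1; funext A v
  cases v <;> rfl

theorem sub_liftEnv_shift {Γ Δ : Ctx ι} {o : Obj ι} {B : Ty ι} (τ : Env Γ Δ) (t : CTm Γ o) :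
    sub (liftEnv τ B) (shift t) = shift (sub τ t) := by
  rw [shift, shift, ren_sub]; exact sub_ren _ _ _

theorem sub_single_zero_ren {Γ : Ctx ι} {o : Obj ι} {B : Ty ι} (t : CTm (B :: Γ) o) :
    sub (single (var .zero)) (ren (liftRen Ren.succ B) t) = t := by
  rw [sub_ren]
  refine Eq.trans ?_ (sub_var t)
  congr 1; funext A v
  cases v <;> rfl

/-- A closed term of every type. -/
def dummy {Γ : Ctx ι} (A : Ty ι) : CTm Γ (.ty A) := mvar [] A 0 nil

/-- Substituting any term for the new variable undoes the weakening, and `dummy` provides one at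
every type. -/
theorem shift_injective {Γ : Ctx ι} {o : Obj ι} {B : Ty ι} :
    Function.Injective (shift : CTm Γ o → CTm (B :: Γ) o) :=
  Function.LeftInverse.injective (g := sub (single (dummy B))) (sub_single_shift _)

/-! ### Tuples as substitutions -/

/-- The component of a tuple at a variable. -/
def lookup {Γ : Ctx ι} : ∀ {Δ : Ctx ι}, CTm Γ (.cx Δ) → Env Δ Γ
  | _, cons a _, _, .zero => a
  | _, cons _ s, _, .succ v => lookup s _ v

/-- The tuple with given components. -/
def tab {Γ : Ctx ι} : ∀ {Δ : Ctx ι}, Env Δ Γ → CTm Γ (.cx Δ)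
  | [], _ => nil
  | _ :: _, τ => cons (τ _ .zero) (tab fun _ v => τ _ (.succ v))

@[simp] theorem lookup_tab {Γ Δ : Ctx ι} (τ : Env Δ Γ) : lookup (tab τ) = τ := by
  funext A v
  induction v with
  | zero => rfl
  | succ v ih => exact ih _

@[simp] theorem tab_lookup {Γ Δ : Ctx ι} (s : CTm Γ (.cx Δ)) : tab (lookup s) = s := by
  induction Δ with
  | nil => cases s; rfl
  | cons A Δ ih => cases s with | cons a s => exact congrArg (cons a) (ih s)

theorem lookup_cons {Γ Δ : Ctx ι} {A : Ty ι} (a : CTm Γ (.ty A)) (s : CTm Γ (.cx Δ)) :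
    lookup (cons a s) = consEnv a (lookup s) := by
  funext B v; cases v <;> rfl

theorem sub_tab {Γ Δ Θ : Ctx ι} (σ : Env Γ Θ) (τ : Env Δ Γ) :
    sub σ (tab τ) = tab fun _ v => sub σ (τ _ v) := by
  induction Δ with
  | nil => rfl
  | cons A Δ ih => exact congrArg (cons _) (ih _)

theorem lookup_sub {Γ Δ Θ : Ctx ι} (σ : Env Γ Θ) (s : CTm Γ (.cx Δ)) :
    lookup (sub σ s) = fun _ v => sub σ (lookup s _ v) := by
  conv_lhs => rw [← tab_lookup s, sub_tab, lookup_tab]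

theorem lookup_ren {Γ Δ Θ : Ctx ι} (ρ : Ren Γ Θ) (s : CTm Γ (.cx Δ)) :
    lookup (ren ρ s) = fun _ v => ren ρ (lookup s _ v) := by
  simp only [ren_eq_sub, lookup_sub]

end CTm

theorem reflTransGen_map {α β : Type*} {r : α → α → Prop} {s : β → β → Prop} (f : α → β)
    (hf : ∀ x y, r x y → s (f x) (f y)) {x y : α} (h : Relation.ReflTransGen r x y) :
    Relation.ReflTransGen s (f x) (f y) := by
  induction h with
  | refl => exact .refl
  | tail _ h ih => exact ih.tail (hf _ _ h)

namespace CTm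

open Lam (liftRen)

variable {ι : Type u}

/-! ### Free variables and strengthening -/

/-- The predicate `P` below an abstraction; the bound variable satisfies it. -/
def liftPred {Γ : Ctx ι} (P : ∀ A, Var Γ A → Prop) (B : Ty ι) : ∀ A, Var (B :: Γ) A → Prop
  | _, .zero => True
  | _, .succ v => P _ v

/-- All free variables satisfy `P`. -/
def FreeVars : ∀ {Γ : Ctx ι} {o : Obj ι}, (∀ A, Var Γ A → Prop) → CTm Γ o → Prop
  | _, _, P, var v => P _ v
  | _, _, P, mvar _ _ _ s => FreeVars P s
  | _, _, P, app a b => FreeVars P a ∧ FreeVars P b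
  | _, _, P, lam a => FreeVars (liftPred P _) a
  | _, _, _, nil => True
  | _, _, P, cons a s => FreeVars P a ∧ FreeVars P s

theorem freeVars_ren {Γ Δ : Ctx ι} {o : Obj ι} (P : ∀ A, Var Δ A → Prop) (ρ : Ren Γ Δ)
    (t : CTm Γ o) : FreeVars P (ren ρ t) ↔ FreeVars (fun _ v => P _ (ρ _ v)) t := by
  induction t generalizing Δ with
  | var v => rfl
  | mvar _ _ _ s ih => exact ih _ _
  | app a b iha ihb => exact and_congr (iha _ _) (ihb _ _)
  | @lam Γ A B a ih =>
    have h : (fun C v => liftPred P A C (liftRen ρ A C v)) =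
        liftPred (fun _ v => P _ (ρ _ v)) A := by
      funext C v; cases v <;> rfl
    simp only [ren, FreeVars, ih, h]
  | nil => rfl
  | cons a s iha ihs => exact and_congr (iha _ _) (ihs _ _)

theorem freeVars_sub {Γ Δ : Ctx ι} {o : Obj ι} (P : ∀ A, Var Δ A → Prop) (τ : Env Γ Δ)
    (t : CTm Γ o) : FreeVars P (sub τ t) ↔ FreeVars (fun _ v => FreeVars P (τ _ v)) t := by
  induction t generalizing Δ with
  | var v => rfl
  | mvar _ _ _ s ih => exact ih _ _
  | app a b iha ihb => exact and_congr (iha _ _) (ihb _ _)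
  | @lam Γ A B a ih =>
    have h : (fun C v => FreeVars (liftPred P A) (liftEnv τ A C v)) =
        liftPred (fun _ v => FreeVars P (τ _ v)) A := by
      funext C v
      cases v with
      | zero => rfl
      | succ v => exact propext (freeVars_ren _ _ _)
    simp only [sub, FreeVars, ih, h]
  | nil => rfl
  | cons a s iha ihs => exact and_congr (iha _ _) (ihs _ _)

theorem freeVars_mono {Γ : Ctx ι} {o : Obj ι} {P Q : ∀ A, Var Γ A → Prop}
    (h : ∀ A v, P A v → Q A v) {t : CTm Γ o} (ht : FreeVars P t) : FreeVars Q t := by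
  induction t with
  | var v => exact h _ _ ht
  | mvar _ _ _ s ih => exact ih h ht
  | app a b iha ihb => exact ⟨iha h ht.1, ihb h ht.2⟩
  | lam a ih =>
    refine ih (fun A v hv => ?_) ht
    cases v with
    | zero => trivial
    | succ v => exact h _ _ hv
  | nil => trivial
  | cons a s iha ihs => exact ⟨iha h ht.1, ihs h ht.2⟩

theorem freeVars_true {Γ : Ctx ι} {o : Obj ι} {P : ∀ A, Var Γ A → Prop}
    (h : ∀ A v, P A v) (t : CTm Γ o) : FreeVars P t := by
  induction t with
  | var v => exact h _ _
  | mvar _ _ _ s ih => exact ih h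
  | app a b iha ihb => exact ⟨iha h, ihb h⟩
  | lam a ih =>
    refine ih (fun A v => ?_)
    cases v with
    | zero => trivial
    | succ v => exact h _ _
  | nil => trivial
  | cons a s iha ihs => exact ⟨iha h, ihs h⟩

/-- Strengthening. It recovers the contractum of an η-redex that becomes visible only after a
renaming or a substitution. -/
theorem exists_ren_of_freeVars {Γ Δ : Ctx ι} {o : Obj ι} (ρ : Ren Γ Δ) (t : CTm Δ o)
    (h : FreeVars (fun A v => ∃ w, ρ A w = v) t) : ∃ t', ren ρ t' = t := by
  induction t generalizing Γ with
  | var v => obtain ⟨w, rfl⟩ := h; exact ⟨var w, rfl⟩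
  | mvar Θ A n s ih => obtain ⟨s', rfl⟩ := ih ρ h; exact ⟨mvar Θ A n s', rfl⟩
  | app a b iha ihb =>
    obtain ⟨a', rfl⟩ := iha ρ h.1
    obtain ⟨b', rfl⟩ := ihb ρ h.2
    exact ⟨app a' b', rfl⟩
  | lam a ih =>
    obtain ⟨a', rfl⟩ := ih (liftRen ρ _) (freeVars_mono (fun A v hv => by
      cases v with
      | zero => exact ⟨.zero, rfl⟩
      | succ v => obtain ⟨w, rfl⟩ := hv; exact ⟨.succ w, rfl⟩) h)
    exact ⟨lam a', rfl⟩
  | nil => exact ⟨nil, rfl⟩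
  | cons a s iha ihs =>
    obtain ⟨a', rfl⟩ := iha ρ h.1
    obtain ⟨r, rfl⟩ := ihs ρ h.2
    exact ⟨cons a' r, rfl⟩

/-- If the bound variable does not occur in `t[1.(τ ∘ ↑)]`, it does not occur in `t`. -/
theorem exists_shift_of_sub_liftEnv {Γ Δ : Ctx ι} {o : Obj ι} {B : Ty ι} {τ : Env Γ Δ}
    {t : CTm (B :: Γ) o} {c : CTm Δ o} (h : sub (liftEnv τ B) t = shift c) :
    ∃ t', t = shift t' ∧ sub τ t' = c := by
  have h1 : FreeVars (fun A v => ∃ w, Ren.succ A w = v) (sub (liftEnv τ B) t) := by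
    rw [h, freeVars_ren]; exact freeVars_true (fun _ v => ⟨v, rfl⟩) _
  -- The bound variable is sent to itself, which is not in the image of `Ren.succ`; so it cannot be
  -- free in `t`.
  obtain ⟨t', rfl⟩ := exists_ren_of_freeVars Ren.succ t <| by
    refine freeVars_mono (fun A v hv => ?_) ((freeVars_sub _ _ _).1 h1)
    cases v with
    | zero => obtain ⟨w, hw⟩ := hv; cases hw
    | succ v => exact ⟨v, rfl⟩
  refine ⟨t', rfl, shift_injective (B := B) ?_⟩
  rw [← h, ← sub_liftEnv_shift]

/-! ### βη-reduction -/

/-- One step of βη-reduction. -/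
inductive Step : ∀ {Γ : Ctx ι} {o : Obj ι}, CTm Γ o → CTm Γ o → Prop
  | beta {Γ : Ctx ι} {A B : Ty ι} (a : CTm (A :: Γ) (.ty B)) (b : CTm Γ (.ty A)) :
      Step (app (lam a) b) (sub (single b) a)
  | eta {Γ : Ctx ι} {A B : Ty ι} {p : CTm (A :: Γ) (.ty (.arrow A B))}
      {a : CTm Γ (.ty (.arrow A B))} : p = shift a → Step (lam (app p (var .zero))) a
  | mvar {Γ : Ctx ι} (Δ : Ctx ι) (A : Ty ι) (n : ℕ) {s s' : CTm Γ (.cx Δ)} :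
      Step s s' → Step (mvar Δ A n s) (mvar Δ A n s')
  | appL {Γ : Ctx ι} {A B : Ty ι} {a a' : CTm Γ (.ty (.arrow A B))} (b : CTm Γ (.ty A)) :
      Step a a' → Step (app a b) (app a' b)
  | appR {Γ : Ctx ι} {A B : Ty ι} (a : CTm Γ (.ty (.arrow A B))) {b b' : CTm Γ (.ty A)} :
      Step b b' → Step (app a b) (app a b')
  | lam {Γ : Ctx ι} {A B : Ty ι} {a a' : CTm (A :: Γ) (.ty B)} :
      Step a a' → Step (lam a) (lam a')
  | consL {Γ Δ : Ctx ι} {A : Ty ι} {a a' : CTm Γ (.ty A)} (s : CTm Γ (.cx Δ)) :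
      Step a a' → Step (cons a s) (cons a' s)
  | consR {Γ Δ : Ctx ι} {A : Ty ι} (a : CTm Γ (.ty A)) {s r : CTm Γ (.cx Δ)} :
      Step s r → Step (cons a s) (cons a r)

/-- βη-reduction in any number of steps. -/
abbrev Steps {Γ : Ctx ι} {o : Obj ι} : CTm Γ o → CTm Γ o → Prop := ReflTransGen Step

/-- Irreducibility. -/
def Irred {Γ : Ctx ι} {o : Obj ι} (t : CTm Γ o) : Prop := ∀ t', ¬ Step t t'

theorem Step.sub {Γ Δ : Ctx ι} {o : Obj ι} {t t' : CTm Γ o} (h : Step t t') (τ : Env Γ Δ) :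
    Step (CTm.sub τ t) (CTm.sub τ t') := by
  induction h generalizing Δ with
  | beta a b => rw [sub_sub_single]; exact .beta _ _
  | eta e => subst e; exact .eta (sub_liftEnv_shift _ _)
  | mvar Δ A n _ ih => exact .mvar _ _ _ (ih τ)
  | appL b _ ih => exact .appL _ (ih τ)
  | appR a _ ih => exact .appR _ (ih τ)
  | lam _ ih => exact .lam (ih _)
  | consL s _ ih => exact .consL _ (ih τ)
  | consR a _ ih => exact .consR _ (ih τ)

theorem Step.ren {Γ Δ : Ctx ι} {o : Obj ι} {t t' : CTm Γ o} (h : Step t t') (ρ : Ren Γ Δ) :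
    Step (CTm.ren ρ t) (CTm.ren ρ t') := by
  rw [ren_eq_sub, ren_eq_sub]; exact h.sub _

namespace Steps

theorem mvar {Γ : Ctx ι} (Δ : Ctx ι) (A : Ty ι) (n : ℕ) {s s' : CTm Γ (.cx Δ)}
    (h : Steps s s') : Steps (mvar Δ A n s) (mvar Δ A n s') :=
  reflTransGen_map _ (fun _ _ h => .mvar _ _ _ h) h

theorem app {Γ : Ctx ι} {A B : Ty ι} {a a' : CTm Γ (.ty (.arrow A B))} {b b' : CTm Γ (.ty A)}
    (ha : Steps a a') (hb : Steps b b') : Steps (app a b) (app a' b') :=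
  (reflTransGen_map (CTm.app · b) (fun _ _ h => .appL _ h) ha).trans
    (reflTransGen_map (CTm.app a') (fun _ _ h => .appR _ h) hb)

theorem lam {Γ : Ctx ι} {A B : Ty ι} {a a' : CTm (A :: Γ) (.ty B)} (h : Steps a a') :
    Steps (lam a) (lam a') :=
  reflTransGen_map _ (fun _ _ h => .lam h) h

theorem cons {Γ Δ : Ctx ι} {A : Ty ι} {a a' : CTm Γ (.ty A)} {s s' : CTm Γ (.cx Δ)}
    (ha : Steps a a') (hs : Steps s s') : Steps (cons a s) (cons a' s') :=
  (reflTransGen_map (CTm.cons · s) (fun _ _ h => .consL _ h) ha).trans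
    (reflTransGen_map (CTm.cons a') (fun _ _ h => .consR _ h) hs)

theorem sub {Γ Δ : Ctx ι} {o : Obj ι} {t t' : CTm Γ o} (h : Steps t t') (τ : Env Γ Δ) :
    Steps (CTm.sub τ t) (CTm.sub τ t') :=
  reflTransGen_map _ (fun _ _ h => h.sub τ) h

theorem ren {Γ Δ : Ctx ι} {o : Obj ι} {t t' : CTm Γ o} (h : Steps t t') (ρ : Ren Γ Δ) :
    Steps (CTm.ren ρ t) (CTm.ren ρ t') :=
  reflTransGen_map _ (fun _ _ h => h.ren ρ) h

theorem sub_env {Γ Δ : Ctx ι} {o : Obj ι} (t : CTm Γ o) {τ τ' : Env Γ Δ}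
    (h : ∀ A v, Steps (τ A v) (τ' A v)) : Steps (CTm.sub τ t) (CTm.sub τ' t) := by
  induction t generalizing Δ with
  | var v => exact h _ _
  | mvar _ _ _ s ih => exact mvar _ _ _ (ih h)
  | app a b iha ihb => exact app (iha h) (ihb h)
  | lam a ih =>
    refine lam (ih fun A v => ?_)
    cases v with
    | zero => exact .refl
    | succ v => exact (h _ _).ren _
  | nil => exact .refl
  | cons a s iha ihs => exact cons (iha h) (ihs h)

end Steps

theorem Step.lookup {Γ Δ : Ctx ι} {s s' : CTm Γ (.cx Δ)} (h : Step s s') {A : Ty ι}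
    (v : Var Δ A) : lookup s A v = lookup s' A v ∨ Step (lookup s A v) (lookup s' A v) := by
  induction v with
  | zero =>
    cases h with
    | consL _ h => exact .inr h
    | consR _ h => exact .inl rfl
  | succ v ih =>
    cases h with
    | consL _ h => exact .inl rfl
    | consR _ h => exact ih h

theorem Steps.lookup {Γ Δ : Ctx ι} {s s' : CTm Γ (.cx Δ)} (h : Steps s s') (A : Ty ι)
    (v : Var Δ A) : Steps (lookup s A v) (lookup s' A v) := by
  induction h with
  | refl => exact .refl
  | tail _ h ih =>
    rcases h.lookup v with h | h
    · rwa [← h]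
    · exact ih.tail h

/-! ### Strong normalization -/

/-- Strong normalization. -/
abbrev SN {Γ : Ctx ι} {o : Obj ι} (t : CTm Γ o) : Prop := Acc (fun a b => Step b a) t

/-- Reducibility. -/
def Red {Γ : Ctx ι} : ∀ A : Ty ι, CTm Γ (.ty A) → Prop
  | .base _, t => SN t
  | .arrow A B, t => ∀ u, Red A u → Red B (app t u)

/-- Being an abstraction. -/
def IsLam {Γ : Ctx ι} {o : Obj ι} : CTm Γ o → Prop
  | lam _ => True
  | _ => False

theorem irred_var {Γ : Ctx ι} {A : Ty ι} (v : Var Γ A) : Irred (var v) := nofun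

theorem irred_dummy {Γ : Ctx ι} (A : Ty ι) : Irred (dummy A : CTm Γ (.ty A)) := by
  intro t h
  cases h with
  | mvar _ _ _ h => cases h

theorem SN.of_sub {Γ Δ : Ctx ι} {o : Obj ι} {t : CTm Γ o} (τ : Env Γ Δ) (h : SN (sub τ t)) :
    SN t := by
  generalize e : sub τ t = x at h
  induction h generalizing t with
  | intro x _ ih => exact ⟨_, fun t' h' => ih _ (e ▸ h'.sub τ) rfl⟩

theorem SN.of_app {Γ : Ctx ι} {A B : Ty ι} {t : CTm Γ (.ty (.arrow A B))} {b : CTm Γ (.ty A)}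
    (h : SN (app t b)) : SN t := by
  generalize e : app t b = x at h
  induction h generalizing t with
  | intro x _ ih => exact ⟨_, fun t' h' => ih _ (e ▸ h'.appL b) rfl⟩

theorem SN.cons {Γ Δ : Ctx ι} {A : Ty ι} {a : CTm Γ (.ty A)} {s : CTm Γ (.cx Δ)}
    (ha : SN a) (hs : SN s) : SN (cons a s) := by
  induction ha generalizing s with
  | intro a ha iha =>
    induction hs with
    | intro s hs ihs =>
      refine ⟨_, fun t h => ?_⟩
      cases h with
      | consL _ h => exact iha _ h ⟨_, hs⟩
      | consR _ h => exact ihs _ h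

/-- Girard's three properties of reducibility candidates. No quantification over larger contexts is
needed in `Red`, since `dummy` is an irreducible neutral inhabitant of each type over each context.
-/
theorem red_properties (A : Ty ι) :
    (∀ {Γ : Ctx ι} (t : CTm Γ (.ty A)), Red A t → SN t) ∧
    (∀ {Γ : Ctx ι} (t t' : CTm Γ (.ty A)), Red A t → Step t t' → Red A t') ∧
    (∀ {Γ : Ctx ι} (t : CTm Γ (.ty A)), ¬ IsLam t → (∀ t', Step t t' → Red A t') → Red A t) := by
  induction A with
  | base i => exact ⟨fun t h => h, fun t t' h h' => h.inv h', fun t _ h => ⟨_, h⟩⟩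
  | arrow A B ihA ihB =>
    refine ⟨fun t h => ?_, fun t t' h h' u hu => ihB.2.1 _ _ (h u hu) (.appL u h'),
      fun t ht h u hu => ?_⟩
    -- The irreducible neutral term `dummy A` is reducible for trivial reasons; applying `t` to it
    -- gives a strongly normalizing term that contains `t`.
    · exact (ihB.1 _ (h (dummy A) (ihA.2.2 _ id fun t' h' => (irred_dummy A t' h').elim))).of_app
    · have hsn := ihA.1 _ hu
      induction hsn with
      | intro u _ ih =>
        refine ihB.2.2 _ id fun t' h' => ?_
        cases h' with
        | beta a b => exact (ht trivial).elim
        | appL _ h' => exact h _ h' _ hu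
        | appR _ h' => exact ih _ h' (ihA.2.1 _ _ hu h')

theorem Red.sn {Γ : Ctx ι} {A : Ty ι} {t : CTm Γ (.ty A)} (h : Red A t) : SN t :=
  (red_properties A).1 t h

theorem Red.step {Γ : Ctx ι} {A : Ty ι} {t t' : CTm Γ (.ty A)} (h : Red A t)
    (h' : Step t t') : Red A t' :=
  (red_properties A).2.1 t t' h h'

theorem Red.of_neutral {Γ : Ctx ι} {A : Ty ι} {t : CTm Γ (.ty A)} (ht : ¬ IsLam t)
    (h : ∀ t', Step t t' → Red A t') : Red A t :=
  (red_properties A).2.2 t ht h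

theorem Red.var {Γ : Ctx ι} {A : Ty ι} (v : Var Γ A) : Red A (var v) :=
  .of_neutral id fun _ h => (irred_var v _ h).elim

theorem Red.dummy {Γ : Ctx ι} (A : Ty ι) : Red A (dummy A : CTm Γ (.ty A)) :=
  .of_neutral id fun _ h => (irred_dummy A _ h).elim

/-- A metavariable forms no redex with its surroundings, at any type, so all reduction takes place
in its tuple. This is why `RedObj` asks no more of tuples than strong normalization. -/
theorem Red.mvar {Γ : Ctx ι} (Δ : Ctx ι) (A : Ty ι) (n : ℕ) {s : CTm Γ (.cx Δ)} (h : SN s) :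
    Red A (mvar Δ A n s) := by
  induction h with
  | intro s _ ih =>
    refine .of_neutral id fun t h => ?_
    cases h with
    | mvar _ _ _ h => exact ih _ h

theorem Red.lam {Γ : Ctx ι} {A B : Ty ι} {a : CTm (A :: Γ) (.ty B)}
    (h : ∀ u, Red A u → Red B (sub (single u) a)) : Red (.arrow A B) (lam a) := by
  intro u hu
  -- Steps survive substitution, so the body inherits strong normalization from a single instance.
  have ha : SN a := (h _ (Red.dummy A)).sn.of_sub
  have hsn := hu.sn
  induction ha generalizing u with
  | intro a _ iha =>
    induction hsn with
    | intro u hu' ihu =>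
      refine .of_neutral id fun t ht => ?_
      cases ht with
      | beta => exact h u hu
      | appL _ ht =>
        cases ht with
        -- The η-contractum applied to `u` coincides with the β-contractum, already known to be
        -- reducible.
        | eta e =>
          have := h u hu
          rw [e] at this
          rwa [CTm.sub, sub_single_shift] at this
        | lam ht => exact iha _ ht (fun u hu => (h u hu).step (ht.sub _)) u hu ⟨_, hu'⟩
      | appR _ ht => exact ihu _ ht (hu.step ht)

/-- Reducible terms, strongly normalizing tuples. -/
def RedObj {Γ : Ctx ι} : ∀ {o : Obj ι}, CTm Γ o → Prop
  | .ty A, t => Red A t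
  | .cx _, s => SN s

/-- The fundamental lemma of the reducibility method; the identity substitution then yields strong
normalization. -/
theorem redObj_sub {Γ Δ : Ctx ι} {o : Obj ι} (t : CTm Γ o) (τ : Env Γ Δ)
    (h : ∀ A v, Red A (τ A v)) : RedObj (sub τ t) := by
  induction t generalizing Δ with
  | var v => exact h _ _
  | mvar _ _ _ s ih => exact Red.mvar _ _ _ (ih τ h)
  | app a b iha ihb => exact iha τ h _ (ihb τ h)
  | lam a ih =>
    refine Red.lam fun u hu => ?_
    rw [sub_single_liftEnv]
    refine ih _ fun A v => ?_
    cases v with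
    | zero => exact hu
    | succ v => exact h _ _
  | nil => exact ⟨_, nofun⟩
  | cons a s iha ihs => exact SN.cons (Red.sn (iha τ h)) (ihs τ h)

theorem strong_normalization {Γ : Ctx ι} {o : Obj ι} (t : CTm Γ o) : SN t := by
  have h := redObj_sub t _ fun _ v => Red.var v
  rw [sub_var] at h
  cases o with
  | ty A => exact Red.sn h
  | cx Δ => exact h

theorem exists_irred {Γ : Ctx ι} {o : Obj ι} (t : CTm Γ o) : ∃ t', Steps t t' ∧ Irred t' := by
  induction strong_normalization t with
  | intro t _ ih =>
    by_cases h : ∃ t', Step t t'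
    · obtain ⟨t', h⟩ := h
      obtain ⟨t'', h1, h2⟩ := ih t' h
      exact ⟨t'', .head h h1, h2⟩
    · exact ⟨t, .refl, fun t' h' => h ⟨t', h'⟩⟩

/-- A step from a term to itself would give an infinite reduction. -/
theorem Step.ne {Γ : Ctx ι} {o : Obj ι} {t t' : CTm Γ o} (h : Step t t') : t ≠ t' := by
  rintro rfl
  induction strong_normalization t with
  | intro t _ ih => exact ih t h h

/-! ### Confluence -/

/-- Having a common reduct. -/
abbrev Join {Γ : Ctx ι} {o : Obj ι} (t t' : CTm Γ o) : Prop := Relation.Join Steps t t'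

theorem Join.of_eq {Γ : Ctx ι} {o : Obj ι} {t t' : CTm Γ o} (h : t = t') : Join t t' :=
  ⟨t, .refl, h ▸ .refl⟩

theorem Join.map {Γ Δ : Ctx ι} {o o' : Obj ι} {t t' : CTm Γ o} (f : CTm Γ o → CTm Δ o')
    (hf : ∀ x y, Step x y → Step (f x) (f y)) (h : Join t t') : Join (f t) (f t') := by
  obtain ⟨x, h1, h2⟩ := h
  exact ⟨f x, reflTransGen_map f hf h1, reflTransGen_map f hf h2⟩

theorem Join.symm {Γ : Ctx ι} {o : Obj ι} {t t' : CTm Γ o} (h : Join t t') : Join t' t := by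
  obtain ⟨x, h1, h2⟩ := h; exact ⟨x, h2, h1⟩

/-- A renaming creates no redexes: β-redexes are visible in the shape of the term, and an η-redex
descends by strengthening. It is needed for steps inside the weakened term of an η-redex. -/
theorem exists_of_step_ren {Γ Δ : Ctx ι} {o : Obj ι} (ρ : Ren Γ Δ) (t : CTm Γ o) {c : CTm Δ o}
    (h : Step (ren ρ t) c) : ∃ t', c = ren ρ t' ∧ Step t t' := by
  induction t generalizing Δ with
  | var v => cases h
  | mvar Θ A n s ih =>
    cases h with
    | mvar _ _ _ h => obtain ⟨s', rfl, h'⟩ := ih ρ h; exact ⟨_, rfl, .mvar _ _ _ h'⟩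
  | app a b iha ihb =>
    simp only [ren] at h
    generalize ea : ren ρ a = a₁ at h
    cases h with
    | beta a' _ =>
      cases a with
      | lam a =>
        cases ea
        refine ⟨_, ?_, .beta a b⟩
        simp only [ren_eq_sub, sub_sub_single, liftEnv_ren]
      | _ => cases ea
    | appL _ h => subst ea; obtain ⟨a', rfl, h'⟩ := iha ρ h; exact ⟨_, rfl, .appL _ h'⟩
    | appR _ h => subst ea; obtain ⟨b', rfl, h'⟩ := ihb ρ h; exact ⟨_, rfl, .appR _ h'⟩
  | lam a ih =>
    simp only [ren] at h
    generalize ea : ren (liftRen ρ _) a = a₁ at h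
    cases h with
    | eta e =>
      cases a with
      | app p q =>
        cases q with
        | var v =>
          cases v with
          | zero =>
            cases ea
            rw [ren_eq_sub, ← liftEnv_ren] at e
            obtain ⟨p', rfl, rfl⟩ := exists_shift_of_sub_liftEnv e
            exact ⟨p', (ren_eq_sub _ _).symm, .eta rfl⟩
          | succ v => cases ea
        | _ => cases ea
      | _ => cases ea
    | lam h => subst ea; obtain ⟨a', rfl, h'⟩ := ih _ h; exact ⟨_, rfl, .lam h'⟩
  | nil => cases h
  | cons a s iha ihs =>
    cases h with
    | consL _ h => obtain ⟨a', rfl, h'⟩ := iha ρ h; exact ⟨_, rfl, .consL _ h'⟩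
    | consR _ h => obtain ⟨s', rfl, h'⟩ := ihs ρ h; exact ⟨_, rfl, .consR _ h'⟩

/-- The critical pairs at a β-redex. Contracting an abstraction by η before it is applied gives the
same term as β. -/
theorem join_beta {Γ : Ctx ι} {A B : Ty ι} {a : CTm (A :: Γ) (.ty B)} {b : CTm Γ (.ty A)}
    {t : CTm Γ (.ty B)} (h : Step (app (lam a) b) t) : Join (sub (single b) a) t := by
  cases h with
  | beta => exact .of_eq rfl
  | appL _ h =>
    cases h with
    | eta e => subst e; exact .of_eq (by simp only [sub, sub_single_shift]; rfl)
    | lam h => exact ⟨_, .single (h.sub _), .single (.beta _ _)⟩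
  | appR _ h =>
    -- The argument may have any number of copies in the contractum; each of them is reduced.
    refine ⟨_, Steps.sub_env a fun C v => ?_, .single (.beta _ _)⟩
    cases v with
    | zero => exact .single h
    | succ v => exact .refl

theorem join_eta {Γ : Ctx ι} {A B : Ty ι} {a t : CTm Γ (.ty (.arrow A B))}
    (h : Step (lam (app (shift a) (var .zero))) t) : Join a t := by
  generalize e : shift a = p at h
  cases h with
  | eta e' => exact .of_eq (shift_injective (e.trans e'))
  | lam h =>
    cases h with
    | beta a' _ =>
      cases a with
      | lam a =>
        cases e
        -- The overlap of η with β: contracting `λ ((λ a)[↑] 1)` by β also gives back `λ a`.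
        exact .of_eq (by rw [sub_single_zero_ren])
      | _ => cases e
    | appL _ h =>
      subst e
      obtain ⟨a', rfl, h'⟩ := exists_of_step_ren _ _ h
      exact ⟨_, .single h', .single (.eta rfl)⟩
    | appR _ h => cases h

theorem local_confluence {Γ : Ctx ι} {o : Obj ι} {t t₁ t₂ : CTm Γ o} (h₁ : Step t t₁)
    (h₂ : Step t t₂) : Join t₁ t₂ := by
  induction h₁ with
  | beta a b => exact join_beta h₂
  | eta e => subst e; exact join_eta h₂
  | mvar _ _ _ h ih =>
    cases h₂ with
    | mvar _ _ _ h' => exact (ih h').map _ fun _ _ h => .mvar _ _ _ h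
  | appL b h ih =>
    cases h₂ with
    | beta => exact (join_beta (.appL _ h)).symm
    | appL _ h' => exact (ih h').map (app · b) fun _ _ h => .appL _ h
    | appR _ h' => exact ⟨_, .single (.appR _ h'), .single (.appL _ h)⟩
  | appR a h ih =>
    cases h₂ with
    | beta => exact (join_beta (.appR _ h)).symm
    | appL _ h' => exact ⟨_, .single (.appL _ h'), .single (.appR _ h)⟩
    | appR _ h' => exact (ih h').map (app a) fun _ _ h => .appR _ h
  | lam h ih =>
    cases h₂ with
    | eta e => subst e; exact (join_eta (.lam h)).symm
    | lam h' => exact (ih h').map lam fun _ _ h => .lam h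
  | consL s h ih =>
    cases h₂ with
    | consL _ h' => exact (ih h').map (cons · s) fun _ _ h => .consL _ h
    | consR _ h' => exact ⟨_, .single (.consR _ h'), .single (.consL _ h)⟩
  | consR a h ih =>
    cases h₂ with
    | consL _ h' => exact ⟨_, .single (.consL _ h'), .single (.consR _ h)⟩
    | consR _ h' => exact (ih h').map (cons a) fun _ _ h => .consR _ h

/-- Newman's lemma. -/
theorem confluence {Γ : Ctx ι} {o : Obj ι} {t t₁ t₂ : CTm Γ o} (h₁ : Steps t t₁)
    (h₂ : Steps t t₂) : Join t₁ t₂ := by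
  induction strong_normalization t generalizing t₁ t₂ with
  | intro t _ ih =>
    rcases h₁.cases_head with rfl | ⟨u₁, s₁, r₁⟩
    · exact ⟨_, h₂, .refl⟩
    rcases h₂.cases_head with rfl | ⟨u₂, s₂, r₂⟩
    · exact ⟨_, .refl, h₁⟩
    obtain ⟨w, w₁, w₂⟩ := local_confluence s₁ s₂
    obtain ⟨x, x₁, x₂⟩ := ih _ s₁ r₁ w₁
    obtain ⟨y, y₁, y₂⟩ := ih _ s₂ r₂ (w₂.trans x₂)
    exact ⟨y, x₁.trans y₂, y₁⟩

theorem Irred.eq_of_steps {Γ : Ctx ι} {o : Obj ι} {t t' : CTm Γ o} (h : Irred t)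
    (h' : Steps t t') : t = t' := by
  rcases h'.cases_head with h' | ⟨u, s, _⟩
  · exact h'
  · exact (h _ s).elim

theorem Join.trans {Γ : Ctx ι} {o : Obj ι} {t₁ t₂ t₃ : CTm Γ o} (h : Join t₁ t₂)
    (h' : Join t₂ t₃) : Join t₁ t₃ := by
  obtain ⟨x, h1, h2⟩ := h
  obtain ⟨y, h3, h4⟩ := h'
  obtain ⟨z, h5, h6⟩ := confluence h2 h3
  exact ⟨z, h1.trans h5, h4.trans h6⟩

theorem Irred.eq_of_join {Γ : Ctx ι} {o : Obj ι} {t t' : CTm Γ o} (h : Irred t)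
    (h' : Irred t') (hj : Join t t') : t = t' := by
  obtain ⟨x, h1, h2⟩ := hj
  rw [h.eq_of_steps h1, h'.eq_of_steps h2]

end CTm

/-! ### Evaluation of λσ-expressions to contextual terms -/

/-- The context over which an expression is defined. -/
abbrev Kind.dom {ι : Type u} : Kind ι → Ctx ι
  | .tm Γ _ => Γ
  | .sb Γ _ => Γ

/-- The classifier of an expression. -/
abbrev Kind.obj {ι : Type u} : Kind ι → Obj ι
  | .tm _ A => .ty A
  | .sb _ Δ => .cx Δ

/-- The kind of the expressions over `Γ` with a given classifier. -/
abbrev Obj.kind {ι : Type u} : Obj ι → Ctx ι → Kind ι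
  | .ty A, Γ => .tm Γ A
  | .cx Δ, Γ => .sb Γ Δ

namespace Exp

variable {ι : Type u}

/-- The contextual term denoted by an expression. -/
def eval : ∀ {k : Kind ι}, Exp k → CTm k.dom k.obj
  | _, one => .var .zero
  | _, mvar Γ A n => .mvar Γ A n (.tab fun _ v => .var v)
  | _, app a b => .app (eval a) (eval b)
  | _, lam a => .lam (eval a)
  | _, clos a s => CTm.sub (CTm.lookup (eval s)) (eval a)
  | _, id => .tab fun _ v => .var v
  | _, shift => .tab fun _ v => .var (.succ v)
  | _, cons a s => .cons (eval a) (eval s)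
  | .sb Γ Θ, comp (Δ := Δ) s t =>
    CTm.sub (Γ := Δ) (Δ := Γ) (CTm.lookup (eval t)) (eval s : CTm Δ (.cx Θ))

-- Each rule of `σ` is a law of simultaneous substitution: associativity, units, projections, or the
-- surjectivity of tupling for `sCons`.
open CTm in
theorem SigmaRule.eval_eq {k : Kind ι} {e e' : Exp k} (h : SigmaRule e e') :
    eval e = eval e' := by
  cases h with
  | app | map | varCons => rfl
  | abs a s =>
    simp only [eval, CTm.sub, lookup_cons, lookup_tab, ← ren_eq_sub, lookup_ren]; rfl
  | clos | assoc => simp only [eval, CTm.sub_sub, lookup_sub]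
  | id | idR => simp only [eval, lookup_tab, sub_var]
  | idL => simp only [eval, sub_tab, CTm.sub, tab_lookup]
  | shiftCons => simp only [eval, sub_tab, CTm.sub, lookup_cons, consEnv, tab_lookup]
  | varShift => rfl
  | sCons s =>
    simp only [eval, sub_tab, CTm.sub]
    exact tab_lookup (eval s)

theorem SigmaStep.eval_eq {k : Kind ι} {e e' : Exp k} (h : SigmaStep e e') :
    eval e = eval e' := by
  induction h with
  | root h => exact h.eval_eq
  | _ => simp only [eval, *]

theorem SigmaConv.eval_eq {k : Kind ι} {e e' : Exp k} (h : SigmaConv e e') :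
    eval e = eval e' := by
  induction h with
  | rel _ _ h => exact h.eval_eq
  | refl => rfl
  | symm _ _ _ ih => exact ih.symm
  | trans _ _ _ _ _ ih ih' => exact ih.trans ih'

theorem eval_clos_shift {Γ : Ctx ι} {A B : Ty ι} (a : Exp (.tm Γ A)) :
    eval (clos a (shift : Exp (.sb (B :: Γ) Γ))) = CTm.shift (eval a) := by
  simp only [eval, CTm.lookup_tab, ← CTm.ren_eq_sub]

/-- A β- or η-step at the root is one step on values. Below a closure or a composition it may be
copied or erased, hence the conclusion with many steps. -/
theorem LambdaSigmaStep.eval_steps {k : Kind ι} {e e' : Exp k} (h : LambdaSigmaStep e e') :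
    CTm.Steps (eval e) (eval e') := by
  induction h with
  | root h =>
    cases h with
    | sigma h => rw [h.eval_eq]
    | beta a b =>
      refine .single ?_
      simp only [eval, CTm.lookup_cons, CTm.lookup_tab]
      exact .beta _ _
    | eta a b h => exact .single (.eta (by rw [h.eval_eq, eval_clos_shift]))
  | appL b _ ih => exact ih.app .refl
  | appR a _ ih => exact CTm.Steps.app .refl ih
  | lam _ ih => exact ih.lam
  | closL s _ ih => exact ih.sub _
  | closR a _ ih => exact CTm.Steps.sub_env _ ih.lookup
  | consL s _ ih => exact ih.cons .refl
  | consR a _ ih => exact CTm.Steps.cons .refl ih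
  | compL t _ ih => exact ih.sub _
  | compR s _ ih => exact CTm.Steps.sub_env _ ih.lookup

theorem eval_steps {k : Kind ι} {e e' : Exp k} (h : ReflTransGen LambdaSigmaStep e e') :
    CTm.Steps (eval e) (eval e') := by
  induction h with
  | refl => exact .refl
  | tail _ h ih => exact ih.trans h.eval_steps

/-! ### Reduction in any number of steps -/

/-- Reduction in any number of steps for the system with the root rules `R`. -/
def CSteps (R : ∀ {k : Kind ι}, Exp k → Exp k → Prop) {k : Kind ι} (e e' : Exp k) : Prop :=
  ReflTransGen (Compat R) e e'

namespace CSteps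

variable {R : ∀ {k : Kind ι}, Exp k → Exp k → Prop}

theorem refl {k : Kind ι} (e : Exp k) : CSteps R e e := ReflTransGen.refl

theorem trans {k : Kind ι} {e₁ e₂ e₃ : Exp k} (h : CSteps R e₁ e₂) (h' : CSteps R e₂ e₃) :
    CSteps R e₁ e₃ := ReflTransGen.trans h h'

theorem root {k : Kind ι} {e e' : Exp k} (h : R e e') : CSteps R e e' :=
  ReflTransGen.single (.root h)

theorem app {Γ : Ctx ι} {A B : Ty ι} {a a' : Exp (.tm Γ (.arrow A B))} {b b' : Exp (.tm Γ A)}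
    (ha : CSteps R a a') (hb : CSteps R b b') : CSteps R (app a b) (app a' b') :=
  trans (reflTransGen_map (Exp.app · b) (fun _ _ h => .appL _ h) ha)
    (reflTransGen_map (Exp.app a') (fun _ _ h => .appR _ h) hb)

theorem lam {Γ : Ctx ι} {A B : Ty ι} {a a' : Exp (.tm (A :: Γ) B)} (h : CSteps R a a') :
    CSteps R (lam a) (lam a') :=
  reflTransGen_map _ (fun _ _ h => .lam h) h

theorem clos {Γ Δ : Ctx ι} {A : Ty ι} {a a' : Exp (.tm Δ A)} {s s' : Exp (.sb Γ Δ)}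
    (ha : CSteps R a a') (hs : CSteps R s s') : CSteps R (clos a s) (clos a' s') :=
  trans (reflTransGen_map (Exp.clos · s) (fun _ _ h => .closL _ h) ha)
    (reflTransGen_map (Exp.clos a') (fun _ _ h => .closR _ h) hs)

theorem cons {Γ Δ : Ctx ι} {A : Ty ι} {a a' : Exp (.tm Γ A)} {s s' : Exp (.sb Γ Δ)}
    (ha : CSteps R a a') (hs : CSteps R s s') : CSteps R (cons a s) (cons a' s') :=
  trans (reflTransGen_map (Exp.cons · s) (fun _ _ h => .consL _ h) ha)
    (reflTransGen_map (Exp.cons a') (fun _ _ h => .consR _ h) hs)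

theorem comp {Γ Δ Θ : Ctx ι} {s s' : Exp (.sb Δ Θ)} {t t' : Exp (.sb Γ Δ)}
    (hs : CSteps R s s') (ht : CSteps R t t') : CSteps R (comp s t) (comp s' t') :=
  trans (reflTransGen_map (Exp.comp · t) (fun _ _ h => .compL _ h) hs)
    (reflTransGen_map (Exp.comp s') (fun _ _ h => .compR _ h) ht)

end CSteps

/-- Reduction in `σ`. -/
abbrev SigmaSteps {k : Kind ι} (e f : Exp k) : Prop := CSteps SigmaRule e f

/-- Reduction in `λσ`. -/
abbrev LambdaSigmaSteps {k : Kind ι} (e f : Exp k) : Prop := CSteps LambdaSigmaRule e f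

theorem Compat.mono {R S : ∀ {k : Kind ι}, Exp k → Exp k → Prop}
    (h : ∀ {k : Kind ι} (e e' : Exp k), R e e' → S e e') {k : Kind ι} {e e' : Exp k}
    (he : Compat R e e') : Compat S e e' := by
  induction he with
  | root h' => exact .root (h _ _ h')
  | appL b _ ih => exact .appL _ ih
  | appR a _ ih => exact .appR _ ih
  | lam _ ih => exact .lam ih
  | closL s _ ih => exact .closL _ ih
  | closR a _ ih => exact .closR _ ih
  | consL s _ ih => exact .consL _ ih
  | consR a _ ih => exact .consR _ ih
  | compL t _ ih => exact .compL _ ih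
  | compR s _ ih => exact .compR _ ih

theorem CSteps.toLambdaSigma {k : Kind ι} {e e' : Exp k} (h : SigmaSteps e e') :
    LambdaSigmaSteps e e' :=
  reflTransGen_map (fun x => x) (fun _ _ h => h.mono fun _ _ h => .sigma h) h

theorem CSteps.eval_eq {k : Kind ι} {e e' : Exp k} (h : SigmaSteps e e') :
    eval e = eval e' := by
  induction h with
  | refl => rfl
  | tail _ h ih => exact ih.trans (SigmaStep.eval_eq h)

theorem CSteps.sigmaConv {k : Kind ι} {e e' : Exp k} (h : SigmaSteps e e') :
    SigmaConv e e' := by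
  induction h with
  | refl => exact .refl _
  | tail _ h ih => exact .trans _ _ _ ih (.rel _ _ h)

/-! ### Normal forms of iterated shifts -/

/-- Contraction of the expression itself, if it is a redex of `σ`. -/
noncomputable def contract {k : Kind ι} (e : Exp k) : Exp k :=
  open Classical in if h : ∃ x, SigmaRule e x then h.choose else e

theorem contract_eq {k : Kind ι} {e x : Exp k} (h : SigmaRule e x)
    (hu : ∀ y, SigmaRule e y → y = x) : contract e = x := by
  have h' : ∃ x, SigmaRule e x := ⟨x, h⟩
  rw [contract, dif_pos h']; exact hu _ h'.choose_spec

theorem contract_eq_self {k : Kind ι} {e : Exp k} (h : ∀ x, ¬ SigmaRule e x) :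
    contract e = e :=
  dif_neg fun ⟨x, hx⟩ => h x hx

theorem contract_spec {k : Kind ι} (e : Exp k) :
    SigmaRule e (contract e) ∨ (contract e = e ∧ ∀ x, ¬ SigmaRule e x) := by
  by_cases h : ∃ x, SigmaRule e x
  · left; rw [contract, dif_pos h]; exact h.choose_spec
  · exact .inr ⟨dif_neg h, fun x hx => h ⟨x, hx⟩⟩

theorem steps_contract {k : Kind ι} (e : Exp k) : SigmaSteps e (contract e) := by
  rcases contract_spec e with h | ⟨h, -⟩
  · exact .root h
  · rw [h]; exact .refl _

end Exp

/-- `Wk Θ Γ`: the context `Γ` is obtained from `Θ` by dropping variables from the top. -/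
inductive Wk {ι : Type u} (Θ : Ctx ι) : Ctx ι → Type u
  | refl : Wk Θ Θ
  | drop {Γ : Ctx ι} {A : Ty ι} : Wk Θ (A :: Γ) → Wk Θ Γ

namespace Wk

variable {ι : Type u}

/-- The renaming given by a weakening. -/
def var {Θ : Ctx ι} : ∀ {Γ : Ctx ι}, Wk Θ Γ → Ren Γ Θ
  | _, refl, _, v => v
  | _, drop w, _, v => w.var _ (.succ v)

/-- Dropping all variables. -/
def toNil {Θ : Ctx ι} : ∀ {Γ : Ctx ι}, Wk Θ Γ → Wk Θ []
  | [], w => w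
  | _ :: _, w => toNil (drop w)

theorem toNil_eq {Θ Γ : Ctx ι} (w : Wk Θ Γ) : w.toNil = (refl : Wk Θ Θ).toNil := by
  induction w with
  | refl => rfl
  | drop w ih => exact ih

end Wk

namespace Exp

variable {ι : Type u}

/-- The normal form of `↑ ∘ s`, when `s` is the shift given by a weakening. -/
def shiftComp : ∀ {Θ Γ : Ctx ι} {A : Ty ι}, Wk Θ (A :: Γ) → Exp (.sb Θ (A :: Γ)) → Exp (.sb Θ Γ)
  | _, _, _, .refl, _ => shift
  | _, _, _, .drop _, s => comp shift s

/-- The normal form of the shift given by a weakening. -/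
def pow {Θ : Ctx ι} : ∀ {Γ : Ctx ι}, Wk Θ Γ → Exp (.sb Θ Γ)
  | _, .refl => id
  | _, .drop w => shiftComp w (pow w)

theorem eval_pow {Θ Γ : Ctx ι} (w : Wk Θ Γ) :
    eval (pow w) = .tab fun _ v => .var (w.var _ v) := by
  induction w with
  | refl => rfl
  | drop w ih =>
    cases w with
    | refl => rfl
    | drop w =>
      rw [pow, shiftComp]; simp only [eval, ih, CTm.lookup_tab, CTm.sub_tab]; rfl

/-- The normal form of a variable of a weakened context. -/
noncomputable def reifyVar {Θ : Ctx ι} {A : Ty ι} :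
    ∀ {Γ : Ctx ι}, Wk Θ Γ → Var Γ A → Exp (.tm Θ A)
  | _, w, .zero => contract (clos one (pow w))
  | _, w, .succ v => reifyVar (.drop w) v

theorem reifyVar_eq {Θ Γ : Ctx ι} {A : Ty ι} (w : Wk Θ Γ) (v : Var Γ A) :
    reifyVar w v = reifyVar .refl (w.var _ v) := by
  induction w with
  | refl => rfl
  | drop w ih => exact ih (.succ v)

theorem contract_one_id {Γ : Ctx ι} {A : Ty ι} :
    contract (clos one id) = (one : Exp (.tm (A :: Γ) A)) :=
  contract_eq (.id _) fun y h => by cases h; rfl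

theorem contract_mvar_id {Γ : Ctx ι} {A : Ty ι} (n : ℕ) :
    contract (clos (mvar Γ A n) id) = mvar Γ A n :=
  contract_eq (.id _) fun y h => by cases h; rfl

theorem contract_one_pow_drop {Θ Γ : Ctx ι} {A B : Ty ι} (w : Wk Θ (B :: A :: Γ)) :
    contract (clos one (pow w.drop)) = clos one (pow w.drop) :=
  contract_eq_self fun y h => by
    cases w with
    | refl => cases h
    | drop w => cases h

theorem contract_sCons {Θ Γ : Ctx ι} {A : Ty ι} (s : Exp (.sb Θ (A :: Γ))) :
    contract (cons (clos one s) (comp shift s)) = s :=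
  contract_eq (.sCons s) fun y h => by cases h; rfl

/-- A tuple of consecutive variables folds into a power of the shift, by `varShift` when nothing has
been dropped and by `sCons` otherwise. -/
theorem contract_cons_pow {Θ Γ : Ctx ι} {A : Ty ι} (w : Wk Θ (A :: Γ)) :
    contract (cons (contract (clos one (pow w))) (pow w.drop)) = pow w := by
  cases w with
  | refl =>
    rw [pow, contract_one_id]
    exact contract_eq .varShift fun y h => by cases h; rfl
  | drop w =>
    rw [contract_one_pow_drop]
    exact contract_sCons _

/-! ### Reification of contextual terms. -/

/-- The λσ-expression of a contextual term; it is in normal form for `σ`. -/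
noncomputable def reify : ∀ {Γ : Ctx ι} {o : Obj ι}, CTm Γ o → Exp (o.kind Γ)
  | _, _, .var v => reifyVar .refl v
  | _, _, .mvar Δ A n s => contract (clos (mvar Δ A n) (reify s))
  | _, _, .app a b => app (reify a) (reify b)
  | _, _, .lam a => lam (reify a)
  | _, _, .nil => pow (Wk.toNil .refl)
  | _, _, .cons a s => contract (cons (reify a) (reify s))

/-- Evaluation, at the kind given by a classifier. -/
def evalObj : ∀ {o : Obj ι} {Γ : Ctx ι}, Exp (o.kind Γ) → CTm Γ o
  | .ty _, _, e => eval e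
  | .cx _, _, e => eval e

theorem eval_contract {k : Kind ι} (e : Exp k) : eval (contract e) = eval e :=
  (steps_contract e).eval_eq.symm

theorem eval_reifyVar {Θ Γ : Ctx ι} {A : Ty ι} (w : Wk Θ Γ) (v : Var Γ A) :
    eval (reifyVar w v) = .var (w.var _ v) := by
  induction v with
  | zero => simp only [reifyVar, eval_contract, eval, eval_pow, CTm.sub, CTm.lookup_tab]
  | succ v ih => exact ih _

theorem evalObj_reify {Γ : Ctx ι} {o : Obj ι} (t : CTm Γ o) : evalObj (reify t) = t := by
  induction t with
  | var v => exact eval_reifyVar _ _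
  | mvar Δ A n s ih =>
    simp only [evalObj] at ih
    simp only [reify, evalObj, eval_contract, eval, ih, CTm.sub, CTm.sub_tab, CTm.tab_lookup]
  | app a b iha ihb => exact congrArg₂ CTm.app iha ihb
  | lam a ih => exact congrArg CTm.lam ih
  | @nil Γ =>
    have := eval_pow (Wk.toNil (.refl : Wk Γ Γ))
    exact this
  | cons a s iha ihs =>
    simp only [reify, evalObj, eval_contract]
    exact congrArg₂ CTm.cons iha ihs

/-- The tuple is folded from its end. Its base is sound because all weakenings to the empty context
agree (`Wk.toNil_eq`), so the empty tuple can be represented by the full power of the shift. -/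
theorem reify_tab_var {Θ Γ : Ctx ι} (w : Wk Θ Γ) :
    reify (.tab fun _ v => .var (w.var _ v)) = pow w := by
  induction Γ with
  | nil => exact congrArg pow (Wk.toNil_eq w).symm
  | cons A Γ ih =>
    have h := ih w.drop
    simp only [CTm.tab, reify]
    rw [← reifyVar_eq]
    refine Eq.trans ?_ (contract_cons_pow w)
    exact congrArg (fun x => contract (cons _ x)) h

theorem reify_injective {Γ : Ctx ι} {o : Obj ι} :
    Function.Injective (reify : CTm Γ o → Exp (o.kind Γ)) :=
  Function.LeftInverse.injective evalObj_reify

theorem eq_of_reify_eq_pow {Θ Γ : Ctx ι} {s : CTm Θ (.cx Γ)} {w : Wk Θ Γ}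
    (h : reify s = pow w) : s = .tab fun _ v => .var (w.var _ v) :=
  reify_injective (h.trans (reify_tab_var w).symm)

/-! ### Reduction to normal forms of `σ` -/

/-- Being of the form `a.s`. -/
def IsCons {k : Kind ι} : Exp k → Prop
  | cons _ _ => True
  | _ => False

/-- The tail of an `sCons`-redex is `↑ ∘ x`. This is not a list, so it is a power of the shift, and
then so is `x`. -/
theorem exists_pow_of_sigmaRule {Θ Γ : Ctx ι} {A : Ty ι} {a : Exp (.tm Θ A)} {s : Exp (.sb Θ Γ)}
    {x : Exp (.sb Θ (A :: Γ))} (hs : IsCons s ∨ ∃ w, s = pow w) (h : SigmaRule (cons a s) x) :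
    ∃ w, x = pow w := by
  cases h with
  | varShift => exact ⟨.refl, rfl⟩
  | sCons =>
    rcases hs with hs | ⟨w, hw⟩
    · exact hs.elim
    · cases w with
      | refl => cases hw
      | drop w =>
        cases w with
        | refl => cases hw
        | drop w => cases hw; exact ⟨_, rfl⟩

theorem reify_isCons_or_pow {Θ Γ : Ctx ι} (s : CTm Θ (.cx Γ)) :
    IsCons (reify s) ∨ ∃ w, reify s = pow w := by
  induction Γ with
  | nil => cases s; exact .inr ⟨_, rfl⟩
  | cons A Γ ih =>
    cases s with
    | cons a s =>
      rcases contract_spec (cons (reify a) (reify s)) with h | ⟨h, -⟩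
      · exact .inr (exists_pow_of_sigmaRule (ih s) h)
      · left; rw [reify, h]; trivial

/-- A tuple is reified to a list of its components, or it consists of the variables given by a
weakening. -/
theorem reify_cons_cases {Θ Γ : Ctx ι} {A : Ty ι} (a : CTm Θ (.ty A)) (s : CTm Θ (.cx Γ)) :
    (reify (.cons a s) = cons (reify a) (reify s) ∧
      ∀ x, ¬ SigmaRule (cons (reify a) (reify s)) x) ∨
    ∃ w : Wk Θ (A :: Γ), CTm.cons a s = .tab fun _ v => .var (w.var _ v) := by
  rcases contract_spec (cons (reify a) (reify s)) with h | h
  · right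
    obtain ⟨w, hw⟩ := exists_pow_of_sigmaRule (reify_isCons_or_pow s) h
    exact ⟨w, eq_of_reify_eq_pow (s := .cons a s) hw⟩
  · exact .inl h

/-! ### Computing with reified substitutions. -/

theorem steps_shift_comp {Θ Γ : Ctx ι} {A : Ty ι} (a : CTm Θ (.ty A)) (s : CTm Θ (.cx Γ)) :
    SigmaSteps (comp shift (reify (.cons a s))) (reify s) := by
  rw [reify]
  have h := contract_spec (cons (reify a) (reify s))
  generalize contract (cons (reify a) (reify s)) = x at h
  generalize (reify s : Exp (.sb Θ Γ)) = s, (reify a : Exp (.tm Θ A)) = a at *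
  rcases h with h | ⟨rfl, -⟩
  -- If the tuple folded to `id`, a unit rule applies; if it folded by `sCons`, the projection is
  -- literally its tail; if it did not fold, `shiftCons` applies.
  · cases h with
    | varShift => exact .root (.idR _)
    | sCons => exact .refl _
  · exact .root (.shiftCons _ _)

theorem steps_one_clos {Θ Γ : Ctx ι} {A : Ty ι} (a : CTm Θ (.ty A)) (s : CTm Θ (.cx Γ)) :
    SigmaSteps (clos one (reify (.cons a s))) (reify a) := by
  rw [reify]
  have h := contract_spec (cons (reify a) (reify s))
  generalize contract (cons (reify a) (reify s)) = x at h
  generalize (reify s : Exp (.sb Θ Γ)) = s, (reify a : Exp (.tm Θ A)) = a at *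
  rcases h with h | ⟨rfl, -⟩
  · cases h with
    | varShift => exact .root (.id _)
    | sCons => exact .refl _
  · exact .root (.varCons _ _)

theorem steps_pow_comp {Θ Γ Δ : Ctx ι} (w : Wk Θ Γ) (s : CTm Δ (.cx Θ)) :
    SigmaSteps (comp (pow w) (reify s)) (reify (.tab fun _ v => s.lookup _ (w.var _ v))) := by
  induction w with
  | refl =>
    have h := s.tab_lookup
    simp only [Wk.var, h]
    exact .root (.idL _)
  | drop w ih =>
    cases w with
    | refl =>
      cases s with
      | cons a s =>
        simpa only [pow, shiftComp, Wk.var, CTm.lookup, CTm.tab_lookup] using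
          steps_shift_comp a s
    | drop w =>
      refine .trans (.root (.assoc _ _ _)) (.trans (.comp (.refl _) ih) ?_)
      exact steps_shift_comp _ _

theorem steps_reifyVar_clos {Θ Γ Δ : Ctx ι} {A : Ty ι} (w : Wk Θ Γ) (v : Var Γ A)
    (s : CTm Δ (.cx Θ)) :
    SigmaSteps (clos (reifyVar w v) (reify s)) (reify (s.lookup _ (w.var _ v))) := by
  induction v with
  | zero =>
    cases w with
    | refl =>
      cases s with
      | cons a s =>
        simp only [reifyVar, pow, contract_one_id]
        exact steps_one_clos a s
    | drop w =>
      rw [reifyVar, contract_one_pow_drop]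
      refine .trans (.root (.clos _ _ _)) (.trans (.clos (.refl _) (steps_pow_comp _ _)) ?_)
      exact steps_one_clos _ _
  | succ v ih => exact ih _

/-- Composition distributes over the components as long as the tuple is a list. If it has folded
into a power of the shift there is nothing to distribute over, and `steps_pow_comp` selects the
components. -/
theorem steps_comp {Θ Γ Δ : Ctx ι} (r : CTm Θ (.cx Γ)) (s : CTm Δ (.cx Θ))
    (h : ∀ A v, SigmaSteps (clos (reify (r.lookup A v)) (reify s))
      (reify (CTm.sub s.lookup (r.lookup A v)))) :
    SigmaSteps (comp (reify r) (reify s)) (reify (CTm.sub s.lookup r)) := by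
  induction Γ with
  | nil => cases r; exact steps_pow_comp _ _
  | cons A Γ ih =>
    cases r with
    | cons a r =>
      rcases reify_cons_cases a r with ⟨hr, -⟩ | ⟨w, hw⟩
      · rw [hr]
        refine .trans (.root (.map _ _ _)) (.trans (.cons (h A .zero) (ih r fun B v => ?_))
          (steps_contract _))
        exact h B (.succ v)
      · rw [hw, reify_tab_var, CTm.sub_tab]
        exact steps_pow_comp w s

theorem reify_id {Γ : Ctx ι} : reify (.tab fun _ v => .var v) = (id : Exp (.sb Γ Γ)) :=
  reify_tab_var .refl

theorem reify_shift {Γ : Ctx ι} {A : Ty ι} :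
    reify (.tab fun _ v => .var (.succ v)) = (shift : Exp (.sb (A :: Γ) Γ)) :=
  reify_tab_var (.drop .refl : Wk (A :: Γ) Γ)

/-- The tuple `1.(s ∘ ↑)`. -/
def liftTuple {Γ Δ : Ctx ι} (s : CTm Δ (.cx Γ)) (A : Ty ι) : CTm (A :: Δ) (.cx (A :: Γ)) :=
  .cons (.var .zero) (CTm.shift s)

theorem lookup_liftTuple {Γ Δ : Ctx ι} (s : CTm Δ (.cx Γ)) (A : Ty ι) :
    (liftTuple s A).lookup = CTm.liftEnv s.lookup A := by
  rw [liftTuple, CTm.lookup_cons, CTm.shift, CTm.lookup_ren]; rfl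

/-- The closures by `s` of the components of `t` reduce as expected. -/
def ClosSteps {Γ Δ : Ctx ι} (s : CTm Δ (.cx Γ)) : ∀ {o : Obj ι}, CTm Γ o → Prop
  | .ty _, t => SigmaSteps (clos (reify t) (reify s)) (reify (CTm.sub s.lookup t))
  | .cx _, r => ∀ A v, SigmaSteps (clos (reify (r.lookup A v)) (reify s))
      (reify (CTm.sub s.lookup (r.lookup A v)))

/-- Below an abstraction `s` becomes `1.(s ∘ ↑)`, so computing a closure presupposes computing `s ∘
↑`, itself made of closures. The class `K` breaks this circle: the induction is run for tuples of
variables, where `s ∘ ↑` is computed directly, and then for all tuples, where the first run supplies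
`s ∘ ↑`. -/
theorem closSteps_of_lift (K : ∀ {Γ Δ : Ctx ι}, CTm Δ (.cx Γ) → Prop)
    (hK : ∀ {Γ Δ : Ctx ι} (s : CTm Δ (.cx Γ)) (A : Ty ι), K s → K (liftTuple s A) ∧
      SigmaSteps (comp (reify s) (shift : Exp (.sb (A :: Δ) Δ))) (reify s.shift))
    {Γ Δ : Ctx ι} {o : Obj ι} (t : CTm Γ o) (s : CTm Δ (.cx Γ)) (hs : K s) :
    ClosSteps s t := by
  induction t generalizing Δ with
  | var v => exact steps_reifyVar_clos .refl v s
  | mvar Θ A n r ih =>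
    have h := steps_comp r s (ih s hs)
    have h' := contract_spec (clos (mvar Θ A n) (reify r))
    simp only [ClosSteps, reify]
    rcases h' with h' | ⟨h', -⟩
    · generalize e : contract (clos (mvar Θ A n) (reify r)) = x at *
      generalize er : reify r = r' at *
      cases h' with
      | id =>
        -- The closure `X[id]` was contracted to `X`; its tuple was the identity, so the result is
        -- `X[s]`.
        have : r = .tab fun _ v => .var v := reify_injective (er.trans reify_id.symm)
        subst this
        simp only [CTm.sub_tab, CTm.sub, CTm.tab_lookup]
        exact steps_contract _
    · rw [h']
      exact .trans (.root (.clos _ _ _)) (.trans (.clos (.refl _) h) (steps_contract _))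
  | app a b iha ihb => exact .trans (.root (.app _ _ _)) (.app (iha s hs) (ihb s hs))
  | @lam Γ A B a ih =>
    obtain ⟨h1, h2⟩ := hK s A hs
    have h3 := ih _ h1
    simp only [ClosSteps, lookup_liftTuple] at h3
    refine .trans (.root (.abs _ _)) (.lam (.trans (.clos (.refl _) ?_) h3))
    refine .trans (.cons ?_ h2) (steps_contract _)
    simp only [reify, reifyVar, pow, contract_one_id]
    exact .refl _
  | nil => exact nofun
  | cons a r iha ihr =>
    intro A v
    cases v with
    | zero => exact iha s hs
    | succ v => exact ihr s hs A v

/-- Tuples of variables. -/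
def IsRen {Γ Δ : Ctx ι} (s : CTm Δ (.cx Γ)) : Prop := ∀ A v, ∃ w, s.lookup A v = .var w

theorem steps_comp_shift_of_isRen {Γ Δ : Ctx ι} (s : CTm Δ (.cx Γ)) (A : Ty ι) (hs : IsRen s) :
    SigmaSteps (comp (reify s) (shift : Exp (.sb (A :: Δ) Δ))) (reify s.shift) := by
  have h := steps_comp s (.tab fun _ v => .var (.succ v) : CTm (A :: Δ) (.cx Δ)) fun B v => by
    obtain ⟨w, hw⟩ := hs B v
    rw [hw]
    exact steps_reifyVar_clos .refl w _
  rwa [reify_shift, CTm.lookup_tab, ← CTm.ren_eq_sub] at h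

theorem isRen_liftTuple {Γ Δ : Ctx ι} {s : CTm Δ (.cx Γ)} (A : Ty ι) (hs : IsRen s) :
    IsRen (liftTuple s A) := by
  intro B v
  rw [lookup_liftTuple]
  cases v with
  | zero => exact ⟨_, rfl⟩
  | succ v =>
    obtain ⟨w, hw⟩ := hs B v
    exact ⟨.succ w, by simp only [CTm.liftEnv, CTm.consEnv, hw]; rfl⟩

theorem closSteps_of_isRen {Γ Δ : Ctx ι} {o : Obj ι} (t : CTm Γ o) (s : CTm Δ (.cx Γ))
    (hs : IsRen s) : ClosSteps s t :=
  closSteps_of_lift IsRen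
    (fun s A hs => ⟨isRen_liftTuple A hs, steps_comp_shift_of_isRen s A hs⟩) t s hs

theorem closSteps {Γ Δ : Ctx ι} {o : Obj ι} (t : CTm Γ o) (s : CTm Δ (.cx Γ)) :
    ClosSteps s t := by
  refine closSteps_of_lift (fun _ => True) (fun s A _ => ⟨trivial, ?_⟩) t s trivial
  have h := steps_comp s _ (closSteps_of_isRen s
    (.tab fun _ v => .var (.succ v) : CTm (A :: _) (.cx _)) fun B v => by simp)
  rwa [reify_shift, CTm.lookup_tab, ← CTm.ren_eq_sub] at h

/-- Reification, at a given kind. -/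
noncomputable def reifyKind : ∀ {k : Kind ι}, CTm k.dom k.obj → Exp k
  | .tm _ _, t => reify t
  | .sb _ _, s => reify s

theorem reify_zero {Γ : Ctx ι} {A : Ty ι} :
    reify (.var .zero) = (one : Exp (.tm (A :: Γ) A)) := contract_one_id

/-- Each constructor is handled by reducing its parts to representatives and then recombining these.
It follows that the value determines the σ-class. -/
theorem steps_reify_eval {k : Kind ι} (e : Exp k) : SigmaSteps e (reifyKind (eval e)) := by
  induction e with
  | one => simp only [reifyKind, eval, reify_zero]; exact .refl _
  | mvar Γ A n =>
    simp only [reifyKind, eval, reify, reify_id, contract_mvar_id]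
    exact .refl _
  | app a b iha ihb => exact .app iha ihb
  | lam a ih => exact .lam ih
  | clos a s iha ihs => exact .trans (.clos iha ihs) (closSteps (eval a) (eval s))
  | id => simp only [reifyKind, eval, reify_id]; exact .refl _
  | shift => simp only [reifyKind, eval, reify_shift]; exact .refl _
  | cons a s iha ihs => exact .trans (.cons iha ihs) (steps_contract _)
  | comp s t ihs iht =>
    exact .trans (.comp ihs iht) (steps_comp (eval s) (eval t) (closSteps (eval s) (eval t)))

theorem sigmaConv_of_eval_eq {k : Kind ι} {e e' : Exp k} (h : eval e = eval e') :
    SigmaConv e e' := by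
  have h1 := steps_reify_eval e
  rw [h] at h1
  exact .trans _ _ _ h1.sigmaConv (.symm _ _ (steps_reify_eval e').sigmaConv)

/-! ### Normal forms of `λσ` -/

theorem irred_tab_var {Γ Δ : Ctx ι} (ρ : Ren Δ Γ) : CTm.Irred (.tab fun _ v => .var (ρ _ v)) := by
  induction Δ with
  | nil => exact nofun
  | cons A Δ ih =>
    intro t h
    cases h with
    | consL _ h => cases h
    | consR _ h => exact ih _ _ h

theorem not_step_one {Γ : Ctx ι} {A : Ty ι} (e : Exp (.tm (A :: Γ) A)) :
    ¬ LambdaSigmaStep one e := by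
  intro h
  cases h with
  | root h =>
    cases h with
    | sigma h => cases h

theorem not_step_mvar {Γ : Ctx ι} {A : Ty ι} {n : ℕ} (e : Exp (.tm Γ A)) :
    ¬ LambdaSigmaStep (mvar Γ A n) e := by
  intro h
  cases h with
  | root h =>
    cases h with
    | sigma h => cases h

theorem not_step_pow {Θ Γ : Ctx ι} (w : Wk Θ Γ) (e : Exp (.sb Θ Γ)) :
    ¬ LambdaSigmaStep (pow w) e := by
  intro h
  induction w with
  | refl =>
    cases h with
    | root h =>
      cases h with
      | sigma h => cases h
  | drop w ih =>
    cases w with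
    | refl =>
      cases h with
      | root h =>
        cases h with
        | sigma h => cases h
    | drop w =>
      cases h with
      | root h =>
        cases h with
        | sigma h => cases w with
          | refl => cases h
          | drop w => cases h
      | compL _ h =>
        cases h with
        | root h =>
          cases h with
          | sigma h => cases h
      | compR _ h => exact ih _ h

/-- The expression `X[s]` is reified to itself, or `s` is the identity and it is reified
to `X`. -/
theorem reify_mvar_cases {Γ : Ctx ι} (Δ : Ctx ι) (A : Ty ι) (n : ℕ) (s : CTm Γ (.cx Δ)) :
    (reify (.mvar Δ A n s) = clos (mvar Δ A n) (reify s) ∧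
      ∀ x, ¬ SigmaRule (clos (mvar Δ A n) (reify s)) x) ∨
    (CTm.Irred s ∧ ∀ e, ¬ LambdaSigmaStep (reify (.mvar Δ A n s)) e) := by
  rcases contract_spec (clos (mvar Δ A n) (reify s)) with h | h
  · right
    simp only [reify]
    generalize contract (clos (mvar Δ A n) (reify s)) = x at h
    generalize e : reify s = s' at h
    cases h with
    | id =>
      have : s = .tab fun _ v => .var v := reify_injective (e.trans reify_id.symm)
      exact ⟨this ▸ irred_tab_var _, not_step_mvar⟩
  · exact .inl h

/-- After `beta`, the σ-rules carry out the closure. The side condition of `eta` is an equality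
modulo `σ`, hence an equality of values. -/
theorem steps_reify {Γ : Ctx ι} {o : Obj ι} {t t' : CTm Γ o} (h : CTm.Step t t') :
    LambdaSigmaSteps (reify t) (reify t') := by
  induction h with
  | beta a b =>
    refine .trans (.root (.beta _ _)) ?_
    have h := closSteps a (.cons b (.tab fun _ v => .var v))
    simp only [ClosSteps, CTm.lookup_cons, CTm.lookup_tab] at h
    refine .trans (.clos (.refl _) ?_) h.toLambdaSigma
    rw [reify, reify_id]
    exact (steps_contract _).toLambdaSigma
  | @eta Γ A B p a e =>
    have h1 : eval (reify p) = p := evalObj_reify p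
    have h2 : eval (reify a) = a := evalObj_reify a
    simp only [reify, reifyVar, pow, contract_one_id]
    refine .root (.eta _ _ (sigmaConv_of_eval_eq ?_))
    rw [eval_clos_shift, h1, h2, e]
  | mvar Δ A n h ih =>
    rcases reify_mvar_cases Δ A n _ with ⟨h', -⟩ | ⟨h', -⟩
    · rw [h']
      exact .trans (.clos (.refl _) ih) (steps_contract _).toLambdaSigma
    · exact (h' _ h).elim
  | appL b _ ih => exact .app ih (.refl _)
  | appR a _ ih => exact .app (.refl _) ih
  | lam _ ih => exact .lam ih
  | consL s h ih =>
    rcases reify_cons_cases _ s with ⟨h', -⟩ | ⟨w, hw⟩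
    · rw [h']
      exact .trans (.cons ih (.refl _)) (steps_contract _).toLambdaSigma
    -- A tuple that folds into a power of the shift consists of variables and cannot reduce.
    · exact (irred_tab_var _ _ (hw ▸ h.consL s)).elim
  | consR a h ih =>
    rcases reify_cons_cases a _ with ⟨h', -⟩ | ⟨w, hw⟩
    · rw [h']
      exact .trans (.cons (.refl _) ih) (steps_contract _).toLambdaSigma
    · exact (irred_tab_var _ _ (hw ▸ h.consR a)).elim

theorem not_step_reifyVar {Θ Γ : Ctx ι} {A : Ty ι} (w : Wk Θ Γ) (v : Var Γ A)
    (e : Exp (.tm Θ A)) : ¬ LambdaSigmaStep (reifyVar w v) e := by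
  induction v with
  | zero =>
    cases w with
    | refl => simpa only [reifyVar, pow, contract_one_id] using not_step_one e
    | drop w =>
      simp only [reifyVar, contract_one_pow_drop]
      intro h
      cases h with
      | root h =>
        cases h with
        | sigma h => cases w with
          | refl => cases h
          | drop w => cases h
      | closL _ h => exact not_step_one _ h
      | closR _ h => exact not_step_pow _ _ h
  | succ v ih => exact ih _ _

/-- The σ-redexes have been removed by `contract`, and a β- or η-redex of the representative would,
after evaluation, be a redex of `t`. -/
theorem not_step_reify {Γ : Ctx ι} {o : Obj ι} (t : CTm Γ o) (ht : t.Irred)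
    (e : Exp (o.kind Γ)) : ¬ LambdaSigmaStep (reify t) e := by
  induction t with
  | var v => exact not_step_reifyVar _ _ _
  | mvar Δ A n s ih =>
    rcases reify_mvar_cases Δ A n s with ⟨h', hr⟩ | ⟨-, h'⟩
    · rw [h']
      intro h
      cases h with
      | root h =>
        cases h with
        | sigma h => exact hr _ h
      | closL _ h => exact not_step_mvar _ h
      | closR _ h => exact ih (fun s' hs => ht _ (.mvar _ _ _ hs)) _ h
    · exact h' e
  | app a b iha ihb =>
    simp only [reify]
    intro h
    generalize ea : reify a = a' at h
    cases h with
    | root h =>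
      cases h with
      | sigma h => cases h
      | beta c _ =>
        have : a = .lam (eval c) := by rw [← evalObj_reify a, ea]; rfl
        subst this
        exact ht _ (.beta _ _)
    | appL _ h => subst ea; exact iha (fun _ h => ht _ (.appL _ h)) _ h
    | appR _ h => exact ihb (fun _ h => ht _ (.appR _ h)) _ h
  | lam a ih =>
    simp only [reify]
    intro h
    generalize ea : reify a = a' at h
    cases h with
    | root h =>
      cases h with
      | sigma h => cases h
      | eta c b h =>
        have : a = .app (eval c) (.var .zero) := by rw [← evalObj_reify a, ea]; rfl
        subst this
        exact ht _ (.eta (by rw [h.eval_eq, eval_clos_shift]))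
    | lam h => subst ea; exact ih (fun _ h => ht _ (.lam h)) _ h
  | nil => exact not_step_pow _ _
  | cons a s iha ihs =>
    rcases reify_cons_cases a s with ⟨h', hr⟩ | ⟨w, hw⟩
    · rw [h']
      intro h
      cases h with
      | root h =>
        cases h with
        | sigma h => exact hr _ h
      | consL _ h => exact iha (fun _ h => ht _ (.consL _ h)) _ h
      | consR _ h => exact ihs (fun _ h => ht _ (.consR _ h)) _ h
    · rw [hw, reify_tab_var]
      exact not_step_pow _ _

theorem eq_of_not_step {k : Kind ι} {e e' : Exp k} (h : ∀ x, ¬ LambdaSigmaStep e x)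
    (h' : LambdaSigmaSteps e e') : e = e' := by
  rcases ReflTransGen.cases_head h' with h' | ⟨x, hx, _⟩
  · exact h'
  · exact (h x hx).elim

theorem steps_reify_of_steps {Γ : Ctx ι} {o : Obj ι} {t t' : CTm Γ o} (h : CTm.Steps t t') :
    LambdaSigmaSteps (reify t) (reify t') := by
  induction h with
  | refl => exact .refl _
  | tail _ h ih => exact ih.trans (steps_reify h)

/-- A λσ-normal form of a term is the reification of the normal form of its value. -/
theorem IsNormalFormOf.eq_reify {Γ : Ctx ι} {A : Ty ι} {e e' : Exp (.tm Γ A)}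
    (h : e'.IsNormalFormOf e) : e' = reify (eval e') ∧ (eval e').Irred := by
  have h1 : e' = reify (eval e') :=
    eq_of_not_step h.2 (steps_reify_eval e').toLambdaSigma
  -- A step of the value lifts to a λσ-reduction starting at the normal form, which must be empty;
  -- by injectivity of `reify` it would be a step from a term to itself.
  refine ⟨h1, fun t ht => ht.ne ?_⟩
  have h2 := steps_reify ht
  rw [← h1] at h2
  have h3 := eq_of_not_step h.2 h2
  exact reify_injective (h1.symm.trans h3)

theorem IsNormalFormOf.steps {Γ : Ctx ι} {A : Ty ι} {e e' : Exp (.tm Γ A)}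
    (h : e'.IsNormalFormOf e) : CTm.Steps (eval e) (eval e') := eval_steps h.1

theorem existsUnique_isNormalFormOf {Γ : Ctx ι} {A : Ty ι} (e : Exp (.tm Γ A)) :
    ∃! e', IsNormalFormOf e' e := by
  obtain ⟨t, h1, h2⟩ := CTm.exists_irred (eval e)
  refine ⟨reify t, ⟨?_, not_step_reify t h2⟩, fun e' h => ?_⟩
  · exact (steps_reify_eval e).toLambdaSigma.trans (steps_reify_of_steps h1)
  · obtain ⟨h3, h4⟩ := h.eq_reify
    rw [h3]
    exact congrArg reify (h4.eq_of_join h2 (CTm.confluence h.steps h1))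

end Exp

/-! ### Grafting of contextual terms -/

namespace CTm

variable {ι : Type u}

/-- Replacement of metavariables: `X[s]` becomes `(θ X)[s]`. -/
def graft (θ : ∀ (Γ : Ctx ι) (A : Ty ι), ℕ → CTm Γ (.ty A)) :
    ∀ {Γ : Ctx ι} {o : Obj ι}, CTm Γ o → CTm Γ o
  | _, _, var v => var v
  | _, _, mvar Δ A n s => sub (lookup (graft θ s)) (θ Δ A n)
  | _, _, app a b => app (graft θ a) (graft θ b)
  | _, _, lam a => lam (graft θ a)
  | _, _, nil => nil
  | _, _, cons a s => cons (graft θ a) (graft θ s)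

variable (θ : ∀ (Γ : Ctx ι) (A : Ty ι), ℕ → CTm Γ (.ty A))

theorem graft_ren {Γ Δ : Ctx ι} {o : Obj ι} (ρ : Ren Γ Δ) (t : CTm Γ o) :
    graft θ (ren ρ t) = ren ρ (graft θ t) := by
  induction t generalizing Δ with
  | var v => rfl
  | mvar _ _ _ s ih => simp only [ren, graft, ih, lookup_ren, ren_sub]
  | app a b iha ihb => simp only [ren, graft, iha, ihb]
  | lam a ih => simp only [ren, graft, ih]
  | nil => rfl
  | cons a s iha ihs => simp only [ren, graft, iha, ihs]

theorem graft_sub {Γ Δ : Ctx ι} {o : Obj ι} (τ : Env Γ Δ) (t : CTm Γ o) :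
    graft θ (sub τ t) = sub (fun _ v => graft θ (τ _ v)) (graft θ t) := by
  induction t generalizing Δ with
  | var v => rfl
  | mvar _ _ _ s ih => simp only [sub, graft, ih, lookup_sub, CTm.sub_sub]
  | app a b iha ihb => simp only [sub, graft, iha, ihb]
  | @lam Γ A B a ih =>
    have h : (fun C v => graft θ (liftEnv τ A C v)) = liftEnv (fun _ v => graft θ (τ _ v)) A := by
      funext C v
      cases v with
      | zero => rfl
      | succ v => exact graft_ren θ _ _
    simp only [sub, graft, ih, h]
  | nil => rfl
  | cons a s iha ihs => simp only [sub, graft, iha, ihs]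

theorem graft_tab {Γ Δ : Ctx ι} (τ : Env Δ Γ) :
    graft θ (tab τ) = tab fun _ v => graft θ (τ _ v) := by
  induction Δ with
  | nil => rfl
  | cons A Δ ih => exact congrArg (cons _) (ih _)

theorem lookup_graft {Γ Δ : Ctx ι} (s : CTm Γ (.cx Δ)) :
    lookup (graft θ s) = fun _ v => graft θ (lookup s _ v) := by
  conv_lhs => rw [← tab_lookup s, graft_tab, lookup_tab]

theorem graft_mvar_id {Γ : Ctx ι} (A : Ty ι) (n : ℕ) :
    graft θ (mvar Γ A n (tab fun _ v => var v)) = θ Γ A n := by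
  simp only [graft, graft_tab, lookup_tab, sub_var]

/-- A step inside a tuple is repeated at every use of the component in the grafted term. -/
theorem Step.graft {Γ : Ctx ι} {o : Obj ι} {t t' : CTm Γ o} (h : Step t t') :
    Steps (graft θ t) (graft θ t') := by
  induction h with
  | @beta Γ A B a b =>
    have h : (fun C v => CTm.graft θ (single b C v)) = single (CTm.graft θ b) := by
      funext C v; cases v <;> rfl
    rw [graft_sub, h]; exact .single (.beta _ _)
  | eta e => subst e; exact .single (.eta (graft_ren θ _ _))
  | mvar Δ A n _ ih => exact Steps.sub_env _ ih.lookup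
  | appL b _ ih => exact ih.app .refl
  | appR a _ ih => exact Steps.app .refl ih
  | lam _ ih => exact ih.lam
  | consL s _ ih => exact ih.cons .refl
  | consR a _ ih => exact Steps.cons .refl ih

theorem Steps.graft {Γ : Ctx ι} {o : Obj ι} {t t' : CTm Γ o} (h : Steps t t') :
    Steps (graft θ t) (graft θ t') := by
  induction h with
  | refl => exact .refl
  | tail _ h ih => exact ih.trans (h.graft θ)

/-- Grafting needs no lifting because the pending substitutions of λσ become the tuples of the
value, and these are applied to whatever is grafted. -/
theorem _root_.Exp.eval_graft (θ : ∀ (Γ : Ctx ι) (A : Ty ι), ℕ → Exp (.tm Γ A)) {k : Kind ι}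
    (e : Exp k) :
    (e.graft θ).eval = CTm.graft (fun Γ A n => (θ Γ A n).eval) e.eval := by
  induction e with
  | one => rfl
  | mvar Γ A n => exact (graft_mvar_id (fun Γ A n => (θ Γ A n).eval) A n).symm
  | app a b iha ihb => exact congrArg₂ app iha ihb
  | lam a ih => exact congrArg lam ih
  | clos a s iha ihs => simp only [Exp.graft, Exp.eval, iha, ihs, graft_sub, lookup_graft]
  | id => simp only [Exp.graft, Exp.eval, graft_tab, CTm.graft]
  | shift => simp only [Exp.graft, Exp.eval, graft_tab, CTm.graft]
  | cons a s iha ihs => exact congrArg₂ cons iha ihs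
  | comp s t ihs iht => simp only [Exp.graft, Exp.eval, ihs, iht, graft_sub, lookup_graft]

end CTm

/-! ### The value of a precooked term -/

/-- The renaming given by a depth. -/
def Depth.var {ι : Type u} {Γ : Ctx ι} : ∀ {Θ : Ctx ι}, Depth Γ Θ → Ren Γ Θ
  | _, .zero, _, v => v
  | _, .succ d, _, v => .succ (d.var _ v)

namespace Lam

open CTm

variable {ι : Type u}

theorem _root_.Exp.lookup_eval_shiftPow {Γ Θ : Ctx ι} (d : Depth Γ Θ) :
    lookup (Exp.shiftPow d).eval = fun _ v => CTm.var (d.var _ v) := by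
  induction d with
  | zero => exact lookup_tab _
  | succ d ih => simp only [Exp.shiftPow, Exp.eval, lookup_sub, lookup_tab, ih, CTm.sub]; rfl

theorem _root_.Var.depth_var {Γ : Ctx ι} {A : Ty ι} (v : Var Γ A) : v.depth.var A .zero = v := by
  induction v with
  | zero => rfl
  | succ v ih => exact congrArg Var.succ ih

/-- The value of the precooked term, after `X ↦ λ ⋯ λ Y`. -/
def value (ν : Ctx ι → Ty ι → ℕ → ℕ) {Γ : Ctx ι} : ∀ {Θ : Ctx ι} {A : Ty ι},
    Depth Γ Θ → Lam Θ A → CTm Θ (.ty A)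
  | _, _, _, var v => .var v
  | _, _, d, mvar A n => CTm.ren d.var (Exp.lamsMVar A Γ (ν Γ A n)).eval
  | _, _, d, app a b => .app (value ν d a) (value ν d b)
  | _, _, d, lam a => .lam (value ν d.succ a)

theorem eval_expand_precookAt (ν : Ctx ι → Ty ι → ℕ → ℕ) {Γ Θ : Ctx ι} {A : Ty ι}
    (d : Depth Γ Θ) (a : Lam Θ A) :
    ((precookAt d a).expand ν).eval = value ν d a := by
  have h : ∀ {Θ Δ : Ctx ι} (d : Depth Δ Θ) (θ : ∀ (Γ : Ctx ι) (A : Ty ι), ℕ → Exp (.tm Γ A)),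
      (Exp.shiftPow d).graft θ = Exp.shiftPow d := by
    intro Θ Δ d θ
    induction d with
    | zero => rfl
    | succ d ih => exact congrArg (Exp.comp · Exp.shift) ih
  induction a with
  | var v =>
    simp only [precookAt, Exp.expand, Exp.graft, h, Exp.eval, CTm.sub, Exp.lookup_eval_shiftPow]
    exact congrArg CTm.var v.depth_var
  | mvar A n =>
    simp only [precookAt, Exp.expand, Exp.graft, h, Exp.eval, value, Exp.lookup_eval_shiftPow,
      ren_eq_sub]
  | app a b iha ihb => exact congrArg₂ CTm.app (iha d) (ihb d)
  | lam a ih => exact congrArg CTm.lam (ih d.succ)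

theorem eval_expand_precook (ν : Ctx ι → Ty ι → ℕ → ℕ) {Γ : Ctx ι} {A : Ty ι} (a : Lam Γ A) :
    (a.precook.expand ν).eval = value ν .zero a := eval_expand_precookAt ν .zero a

/-! ### βη-equality -/

namespace Conv

theorem map {Γ Δ : Ctx ι} {A B : Ty ι} (f : Lam Γ A → Lam Δ B)
    (hf : ∀ x y, Step x y → Step (f x) (f y)) {a b : Lam Γ A} (h : Conv a b) :
    Conv (f a) (f b) := by
  induction h with
  | rel _ _ h => exact .rel _ _ (hf _ _ h)
  | refl => exact .refl _
  | symm _ _ _ ih => exact .symm _ _ ih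
  | trans _ _ _ _ _ ih ih' => exact .trans _ _ _ ih ih'

theorem app {Γ : Ctx ι} {A B : Ty ι} {a a' : Lam Γ (.arrow A B)} {b b' : Lam Γ A}
    (ha : Conv a a') (hb : Conv b b') : Conv (app a b) (app a' b') :=
  .trans _ _ _ (ha.map (Lam.app · b) fun _ _ h => .appL _ h)
    (hb.map (Lam.app a') fun _ _ h => .appR _ h)

end Conv

end Lam

/-! ### From contextual terms to λ-terms -/

namespace CTm

variable {ι : Type u}

/-- The λ-terms with a given classifier; tuples are forgotten. -/
abbrev Collapsed (Γ : Ctx ι) : Obj ι → Type u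
  | .ty A => Lam Γ A
  | .cx _ => PUnit

/-- The λ-term in which the tuples of the metavariables are dropped. -/
def collapse : ∀ {Γ : Ctx ι} {o : Obj ι}, CTm Γ o → Collapsed Γ o
  | _, _, var v => Lam.var v
  | _, _, mvar _ A n _ => Lam.mvar A n
  | _, _, app a b => Lam.app (collapse a) (collapse b)
  | _, _, lam a => Lam.lam (collapse a)
  | _, _, nil => ⟨⟩
  | _, _, cons _ _ => ⟨⟩

/-- Renaming of collapsed terms. -/
def renCollapsed {Γ Δ : Ctx ι} (ρ : Ren Γ Δ) : ∀ {o : Obj ι}, Collapsed Γ o → Collapsed Δ o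
  | .ty _, a => Lam.ren ρ a
  | .cx _, _ => ⟨⟩

/-- Substitution of collapsed terms. -/
def subCollapsed {Γ Δ : Ctx ι} (τ : ∀ A, Var Γ A → Lam Δ A) :
    ∀ {o : Obj ι}, Collapsed Γ o → Collapsed Δ o
  | .ty _, a => Lam.sub τ a
  | .cx _, _ => ⟨⟩

/-- βη-equality of collapsed terms. -/
def ConvCollapsed {Γ : Ctx ι} : ∀ {o : Obj ι}, Collapsed Γ o → Collapsed Γ o → Prop
  | .ty _, a, b => Lam.Conv a b
  | .cx _, _, _ => True

theorem collapse_ren {Γ Δ : Ctx ι} {o : Obj ι} (ρ : Ren Γ Δ) (t : CTm Γ o) :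
    collapse (ren ρ t) = renCollapsed ρ (collapse t) := by
  induction t generalizing Δ with
  | var v => rfl
  | mvar _ _ _ s ih => rfl
  | app a b iha ihb => exact congrArg₂ Lam.app (iha ρ) (ihb ρ)
  | lam a ih => exact congrArg Lam.lam (ih _)
  | nil => rfl
  | cons a s iha ihs => rfl

theorem collapse_sub {Γ Δ : Ctx ι} {o : Obj ι} (τ : Env Γ Δ) (t : CTm Γ o) :
    collapse (sub τ t) = subCollapsed (fun _ v => collapse (τ _ v)) (collapse t) := by
  induction t generalizing Δ with
  | var v => rfl
  | mvar _ _ _ s ih => rfl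
  | app a b iha ihb => exact congrArg₂ Lam.app (iha τ) (ihb τ)
  | @lam Γ A B a ih =>
    refine congrArg Lam.lam ((ih _).trans ?_)
    refine congrArg (fun τ => Lam.sub τ (collapse a)) ?_
    funext C v
    cases v with
    | zero => rfl
    | succ v => exact collapse_ren _ _
  | nil => rfl
  | cons a s iha ihs => rfl

/-- A step inside a tuple becomes invisible; the other steps survive because `collapse` commutes
with substitution. -/
theorem Step.collapse {Γ : Ctx ι} {o : Obj ι} {t t' : CTm Γ o} (h : Step t t') :
    ConvCollapsed (collapse t) (collapse t') := by
  induction h with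
  | beta a b =>
    rw [collapse_sub]
    refine .rel _ _ ?_
    have h : (fun C v => CTm.collapse (single b C v)) = Lam.single (CTm.collapse b) := by
      funext C v; cases v <;> rfl
    rw [h]
    exact .beta _ _
  | eta e =>
    subst e
    refine .rel _ _ ?_
    simp only [CTm.collapse, collapse_ren]
    exact .eta _
  | mvar Δ A n _ ih => exact .refl _
  | appL b _ ih => exact Lam.Conv.app ih (.refl _)
  | appR a _ ih => exact Lam.Conv.app (.refl _) ih
  | lam _ ih => exact Lam.Conv.map _ (fun _ _ h => .lam h) ih
  | consL s _ ih => trivial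
  | consR a _ ih => trivial

theorem Steps.collapse {Γ : Ctx ι} {A : Ty ι} {t t' : CTm Γ (.ty A)} (h : Steps t t') :
    Lam.Conv (collapse t) (collapse t') := by
  induction h with
  | refl => exact .refl _
  | tail _ h ih => exact .trans _ _ _ ih h.collapse

theorem ren_depth_succ {Γ Θ : Ctx ι} {o : Obj ι} {A : Ty ι} (d : Depth Γ Θ) (t : CTm Γ o) :
    ren (d.succ (A := A)).var t = shift (ren d.var t) :=
  (ren_ren Ren.succ d.var t).symm

theorem ren_depth_zero {Γ : Ctx ι} {o : Obj ι} (t : CTm Γ o) :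
    ren (Depth.zero : Depth Γ Γ).var t = t := (ren_eq_sub _ _).trans (sub_var t)

theorem collapse_ren_depth {Γ Θ : Ctx ι} {A : Ty ι} (d : Depth Γ Θ) (t : CTm Γ (.ty A)) :
    collapse (ren d.var t) = Lam.shiftBy (collapse t) d := by
  induction d with
  | zero => rw [ren_depth_zero]; rfl
  | succ d ih => rw [ren_depth_succ, collapse_ren, ih]; rfl

theorem instAt_collapse (ν : Ctx ι → Ty ι → ℕ → ℕ) {Γ Θ : Ctx ι} {A : Ty ι}
    (θ : ∀ (Γ : Ctx ι) (A : Ty ι), ℕ → CTm Γ (.ty A)) (d : Depth Γ Θ) (a : Lam Θ A) :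
    Lam.instAt (fun A n => collapse (graft θ (Exp.lamsMVar A Γ (ν Γ A n)).eval)) d a =
      collapse (graft θ (Lam.value ν d a)) := by
  induction a with
  | var v => rfl
  | mvar A n => simp only [Lam.instAt, Lam.value, graft_ren, collapse_ren_depth]
  | app a b iha ihb => exact congrArg₂ Lam.app (iha d) (ihb d)
  | lam a ih => exact congrArg Lam.lam (ih d.succ)

end CTm

/-- The λ-solution sends `X` to the collapse of the grafted `λ ⋯ λ Y`. Both instances are βη-equal
to the collapse of one common value. -/
theorem Exp.hasSolution_of_hasSigmaSolution {ι : Type u} {Γ : Ctx ι} {A : Ty ι} {a b : Lam Γ A}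
    {ν : Ctx ι → Ty ι → ℕ → ℕ} {a' b' : Exp (.tm Γ A)}
    (ha : a'.IsNormalFormOf (a.precook.expand ν)) (hb : b'.IsNormalFormOf (b.precook.expand ν))
    (h : HasSigmaSolution a' b') : Lam.HasSolution a b := by
  obtain ⟨θ, hθ⟩ := h
  refine ⟨fun A n => CTm.collapse (CTm.graft (fun Γ A n => (θ Γ A n).eval)
    (lamsMVar A Γ (ν Γ A n)).eval), ?_⟩
  simp only [Lam.inst, CTm.instAt_collapse ν (fun Γ A n => (θ Γ A n).eval)]
  have ha' := (ha.steps.graft fun Γ A n => (θ Γ A n).eval).collapse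
  have hb_conv := (hb.steps.graft fun Γ A n => (θ Γ A n).eval).collapse
  rw [Lam.eval_expand_precook] at ha' hb_conv
  have e := hθ.eval_eq
  rw [eval_graft, eval_graft] at e
  rw [e] at ha'
  exact .trans _ _ _ ha' (.symm _ _ hb_conv)

/-! ### From λ-terms to contextual terms -/

namespace Lam

variable {ι : Type u}

/-- A λ-term as a contextual term; its metavariables get the empty context. -/
def embed : ∀ {Γ : Ctx ι} {A : Ty ι}, Lam Γ A → CTm Γ (.ty A)
  | _, _, var v => .var v
  | _, _, mvar A n => .mvar [] A n .nil
  | _, _, app a b => .app (embed a) (embed b)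
  | _, _, lam a => .lam (embed a)

theorem embed_ren {Γ Δ : Ctx ι} {A : Ty ι} (ρ : Ren Γ Δ) (a : Lam Γ A) :
    embed (ren ρ a) = CTm.ren ρ (embed a) := by
  induction a generalizing Δ with
  | var v => rfl
  | mvar A n => rfl
  | app a b iha ihb => exact congrArg₂ CTm.app (iha ρ) (ihb ρ)
  | lam a ih => exact congrArg CTm.lam (ih _)

/-- A metavariable over the empty context has an empty tuple, so substitution leaves it alone, just
as in the λ-calculus. -/
theorem embed_sub {Γ Δ : Ctx ι} {A : Ty ι} (τ : ∀ A, Var Γ A → Lam Δ A) (a : Lam Γ A) :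
    embed (sub τ a) = CTm.sub (fun _ v => embed (τ _ v)) (embed a) := by
  induction a generalizing Δ with
  | var v => rfl
  | mvar A n => rfl
  | app a b iha ihb => exact congrArg₂ CTm.app (iha τ) (ihb τ)
  | lam a ih =>
    refine congrArg CTm.lam ((ih _).trans ?_)
    refine congrArg (fun τ => CTm.sub τ (embed a)) ?_
    funext C v
    cases v with
    | zero => rfl
    | succ v => exact embed_ren _ _

theorem Step.embed {Γ : Ctx ι} {A : Ty ι} {a b : Lam Γ A} (h : Step a b) :
    CTm.Step (embed a) (embed b) := by
  induction h with
  | beta a b =>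
    have h : (fun C v => Lam.embed (single b C v)) = CTm.single (Lam.embed b) := by
      funext C v; cases v <;> rfl
    rw [embed_sub, h]
    exact .beta _ _
  | eta a => exact .eta (embed_ren _ _)
  | appL b _ ih => exact .appL _ ih
  | appR a _ ih => exact .appR _ ih
  | lam _ ih => exact .lam ih

theorem Conv.embed {Γ : Ctx ι} {A : Ty ι} {a b : Lam Γ A} (h : Conv a b) :
    CTm.Join (embed a) (embed b) := by
  induction h with
  | rel _ _ h => exact ⟨_, .single h.embed, .refl⟩
  | refl => exact .of_eq rfl
  | symm _ _ _ ih => exact ih.symm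
  | trans _ _ _ _ _ ih ih' => exact ih.trans ih'

theorem embed_shiftBy {Γ Θ : Ctx ι} {A : Ty ι} (d : Depth Γ Θ) (a : Lam Γ A) :
    embed (shiftBy a d) = CTm.ren d.var (embed a) := by
  induction d with
  | zero => rw [CTm.ren_depth_zero]; rfl
  | succ d ih => rw [CTm.ren_depth_succ, ← ih]; exact embed_ren _ _

theorem join_embed_instAt (ν : Ctx ι → Ty ι → ℕ → ℕ) {Γ Θ : Ctx ι} {A : Ty ι}
    (θ : ∀ A : Ty ι, ℕ → Lam Γ A) (U : ∀ (Γ : Ctx ι) (A : Ty ι), ℕ → CTm Γ (.ty A))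
    (d : Depth Γ Θ) (a : Lam Θ A)
    (h : ∀ X ∈ a.mvars, CTm.Join (embed (θ X.1 X.2))
      (CTm.graft U (Exp.lamsMVar X.1 Γ (ν Γ X.1 X.2)).eval)) :
    CTm.Join (embed (instAt θ d a)) (CTm.graft U (value ν d a)) := by
  induction a with
  | var v => exact .of_eq rfl
  | mvar A n =>
    simp only [instAt, value, embed_shiftBy, CTm.graft_ren]
    exact (h (A, n) rfl).map _ fun _ _ h => h.ren _
  | app a b iha ihb =>
    obtain ⟨x, h1, h2⟩ := iha d fun X hX => h X (.inl hX)
    obtain ⟨y, h3, h4⟩ := ihb d fun X hX => h X (.inr hX)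
    exact ⟨.app x y, h1.app h3, h2.app h4⟩
  | lam a ih => exact (ih d.succ h).map _ fun _ _ h => .lam h

theorem mem_mvars_precookAt {Γ Θ : Ctx ι} {A : Ty ι} (d : Depth Γ Θ) (a : Lam Θ A)
    {X : Ty ι × ℕ} (h : X ∈ a.mvars) : (Γ, X) ∈ (precookAt d a).mvars := by
  induction a with
  | var v => exact h.elim
  | mvar A n => cases h; exact .inl rfl
  | app a b iha ihb => exact h.imp (iha d) (ihb d)
  | lam a ih => exact ih d.succ h

end Lam

namespace CTm

variable {ι : Type u}

/-! ### Bodies of terms of functional type -/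

/-- The term `λ ⋯ λ u`. -/
def lams : ∀ (A : Ty ι) {Γ : Ctx ι}, CTm (A.bodyCtx Γ) (.ty A.target) → CTm Γ (.ty A)
  | .base _, _, u => u
  | .arrow _ B, _, u => lam (lams B u)

/-- The application of a weakened term to the new variables. -/
def body : ∀ (A : Ty ι) {Γ : Ctx ι}, CTm Γ (.ty A) → CTm (A.bodyCtx Γ) (.ty A.target)
  | .base _, _, t => t
  | .arrow _ B, _, t => body B (app (shift t) (var .zero))

theorem Steps.lams (A : Ty ι) {Γ : Ctx ι} {u u' : CTm (A.bodyCtx Γ) (.ty A.target)}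
    (h : Steps u u') : Steps (lams A u) (lams A u') := by
  induction A generalizing Γ with
  | base i => exact h
  | arrow A B _ ih => exact (ih h).lam

theorem lams_body (A : Ty ι) {Γ : Ctx ι} (t : CTm Γ (.ty A)) : Steps (lams A (body A t)) t := by
  induction A generalizing Γ with
  | base i => exact .refl
  | arrow A B _ ih => exact (ih _).lam.tail (.eta rfl)

theorem graft_lamsMVar (U : ∀ (Γ : Ctx ι) (A : Ty ι), ℕ → CTm Γ (.ty A)) (A : Ty ι) (Γ : Ctx ι)
    (y : ℕ) : graft U (Exp.lamsMVar A Γ y).eval = lams A (U (A.bodyCtx Γ) A.target y) := by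
  induction A generalizing Γ with
  | base i => exact graft_mvar_id U _ _
  | arrow A B _ ih => exact congrArg lam (ih _)

/-! ### Terms whose metavariables have arguments of atomic type only -/

/-- Every metavariable has atomic type, and its tuple consists of terms of atomic types and of
variables of the context `Γ`. -/
def Flat {Γ : Ctx ι} : ∀ {Θ : Ctx ι} {o : Obj ι}, Depth Γ Θ → CTm Θ o → Prop
  | _, _, _, var _ => True
  | _, _, d, mvar Δ A _ s => A.IsAtomic ∧ (∀ B (v : Var Δ B), B.IsAtomic ∨
      ∃ w, lookup s B v = var (d.var B w)) ∧ Flat d s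
  | _, _, d, app a b => Flat d a ∧ Flat d b
  | _, _, d, lam a => Flat d.succ a
  | _, _, _, nil => True
  | _, _, d, cons a s => Flat d a ∧ Flat d s

theorem Flat.ren {Γ Θ Θ' : Ctx ι} {o : Obj ι} {d : Depth Γ Θ} {d' : Depth Γ Θ'} {ρ : Ren Θ Θ'}
    (hρ : ∀ B w, ρ B (d.var B w) = d'.var B w) {t : CTm Θ o} (h : Flat d t) :
    Flat d' (ren ρ t) := by
  induction t generalizing Θ' with
  | var v => trivial
  | mvar Δ A n s ih =>
    refine ⟨h.1, fun B v => (h.2.1 B v).imp_right ?_, ih hρ h.2.2⟩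
    rintro ⟨w, hw⟩
    exact ⟨w, by simp only [lookup_ren, hw, ← hρ]; rfl⟩
  | app a b iha ihb => exact ⟨iha hρ h.1, ihb hρ h.2⟩
  | lam a ih => exact ih (d := d.succ) (d' := d'.succ) (fun B w => congrArg Var.succ (hρ B w)) h
  | nil => trivial
  | cons a s iha ihs => exact ⟨iha hρ h.1, ihs hρ h.2⟩

/-- For the η-rule, which removes a bound variable; `hρ` says that the variables of `Γ` are
reflected. -/
theorem Flat.of_ren {Γ Θ Θ' : Ctx ι} {o : Obj ι} {d : Depth Γ Θ} {d' : Depth Γ Θ'} {ρ : Ren Θ Θ'}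
    (hρ : ∀ B x w, ρ B x = d'.var B w → x = d.var B w) {t : CTm Θ o} (h : Flat d' (CTm.ren ρ t)) :
    Flat d t := by
  induction t generalizing Θ' with
  | var v => trivial
  | mvar Δ A n s ih =>
    refine ⟨h.1, fun B v => (h.2.1 B v).imp_right ?_, ih hρ h.2.2⟩
    rintro ⟨w, hw⟩
    refine ⟨w, ?_⟩
    simp only [lookup_ren] at hw
    generalize lookup s B v = x at hw
    cases x with
    | var x => exact congrArg var (hρ _ _ _ (by injection hw))
    | _ => cases hw
  | app a b iha ihb => exact ⟨iha hρ h.1, ihb hρ h.2⟩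
  | lam a ih =>
    refine ih (d := d.succ) (d' := d'.succ) (fun B x w hx => ?_) h
    cases x with
    | zero => cases hx
    | succ x => exact congrArg Var.succ (hρ _ _ _ (by injection hx))
  | nil => trivial
  | cons a s iha ihs => exact ⟨iha hρ h.1, ihs hρ h.2⟩

/-- Arguments of atomic type keep their type, and the variables of `Γ` are fixed. Only variables
bound above them are replaced when a β-redex is contracted. -/
theorem Flat.sub {Γ Θ Θ' : Ctx ι} {o : Obj ι} {d : Depth Γ Θ} {d' : Depth Γ Θ'} {τ : Env Θ Θ'}
    (hτ : ∀ B w, τ B (d.var B w) = var (d'.var B w)) (hτ' : ∀ B v, Flat d' (τ B v)) {t : CTm Θ o}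
    (h : Flat d t) : Flat d' (sub τ t) := by
  induction t generalizing Θ' with
  | var v => exact hτ' _ _
  | mvar Δ A n s ih =>
    refine ⟨h.1, fun B v => (h.2.1 B v).imp_right ?_, ih hτ hτ' h.2.2⟩
    rintro ⟨w, hw⟩
    exact ⟨w, by simp only [lookup_sub, hw, ← hτ]; rfl⟩
  | app a b iha ihb => exact ⟨iha hτ hτ' h.1, ihb hτ hτ' h.2⟩
  | lam a ih =>
    refine ih (d := d.succ) (d' := d'.succ)
      (fun B w => congrArg (CTm.ren Ren.succ) (hτ B w)) (fun B v => ?_) h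
    cases v with
    | zero => trivial
    | succ v => exact (hτ' B v).ren fun _ _ => rfl
  | nil => trivial
  | cons a s iha ihs => exact ⟨iha hτ hτ' h.1, ihs hτ hτ' h.2⟩

theorem Step.flat {Γ Θ : Ctx ι} {o : Obj ι} {d : Depth Γ Θ} {t t' : CTm Θ o} (h : Step t t')
    (ht : Flat d t) : Flat d t' := by
  induction h with
  | beta a b =>
    refine Flat.sub (d := d.succ) (τ := single b) (fun B w => rfl) (fun B v => ?_) ht.1
    cases v with
    | zero => exact ht.2
    | succ v => trivial
  | eta e =>
    subst e
    exact Flat.of_ren (d' := d.succ) (fun B x w hx => by injection hx) ht.1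
  | mvar Δ A n h ih =>
    refine ⟨ht.1, fun B v => (ht.2.1 B v).imp_right ?_, ih ht.2.2⟩
    rintro ⟨w, hw⟩
    refine ⟨w, ?_⟩
    rcases h.lookup v with h' | h'
    · rw [← h', hw]
    · rw [hw] at h'; cases h'
  | appL b _ ih => exact ⟨ih ht.1, ht.2⟩
  | appR a _ ih => exact ⟨ht.1, ih ht.2⟩
  | lam _ ih => exact ih (d := d.succ) ht
  | consL s _ ih => exact ⟨ih ht.1, ht.2⟩
  | consR a _ ih => exact ⟨ht.1, ih ht.2⟩

theorem Steps.flat {Γ Θ : Ctx ι} {o : Obj ι} {d : Depth Γ Θ} {t t' : CTm Θ o} (h : Steps t t')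
    (ht : Flat d t) : Flat d t' := by
  induction h with
  | refl => exact ht
  | tail _ h ih => exact h.flat ih

theorem _root_.Ty.isAtomic_of_order_le_one {A : Ty ι} (h : A.order ≤ 1) : A.IsAtomic := by
  have hpos : ∀ A : Ty ι, 1 ≤ A.order := by
    intro A
    induction A with
    | base i => exact le_rfl
    | arrow A B _ ih => exact ih.trans (le_max_right _ _)
  cases A with
  | base i => exact ⟨i, rfl⟩
  | arrow A B =>
    have h1 := hpos A
    have h2 : A.order + 1 ≤ 1 := (le_max_left _ _).trans h
    omega

theorem flat_tab_var {Γ Θ Δ : Ctx ι} (d : Depth Γ Θ) (ρ : Ren Δ Θ) :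
    Flat d (tab fun _ v => var (ρ _ v)) := by
  induction Δ with
  | nil => trivial
  | cons A Δ ih => exact ⟨trivial, ih _⟩

theorem flat_lamsMVar {Γ Θ : Ctx ι} (d : Depth Γ Θ) (A : Ty ι) (hA : A.order ≤ 2) (y : ℕ)
    (hd : ∀ B (v : Var Θ B), B.IsAtomic ∨ ∃ w, v = d.var B w) :
    Flat d (Exp.lamsMVar A Θ y).eval := by
  induction A generalizing Θ with
  | base i =>
    refine ⟨⟨i, rfl⟩, fun B v => (hd B v).imp_right ?_, flat_tab_var d fun _ v => v⟩
    rintro ⟨w, rfl⟩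
    exact ⟨w, by rw [lookup_tab]⟩
  | arrow A B _ ih =>
    refine ih d.succ ((le_max_right _ _).trans hA) fun C v => ?_
    cases v with
    | zero =>
      -- A metavariable of order at most two takes arguments of order one, that is, of atomic type.
      have h : A.order + 1 ≤ 2 := (le_max_left _ _).trans hA
      exact .inl (Ty.isAtomic_of_order_le_one (by omega))
    | succ v =>
      refine (hd C v).imp_right ?_
      rintro ⟨w, rfl⟩
      exact ⟨w, rfl⟩

theorem flat_value (ν : Ctx ι → Ty ι → ℕ → ℕ) {Γ Θ : Ctx ι} {A : Ty ι} (d : Depth Γ Θ)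
    (a : Lam Θ A) (h : ∀ X ∈ a.mvars, X.1.order ≤ 2) : Flat d (a.value ν d) := by
  induction a with
  | var v => trivial
  | mvar A n =>
    exact (flat_lamsMVar .zero A (h (A, n) rfl) _ fun B v => .inr ⟨v, rfl⟩).ren fun _ _ => rfl
  | app a b iha ihb =>
    exact ⟨iha d fun X hX => h X (.inl hX), ihb d fun X hX => h X (.inr hX)⟩
  | lam a ih => exact ih d.succ h

/-! ### Grafting irreducible terms -/

theorem Irred.ren {Γ Δ : Ctx ι} {o : Obj ι} {t : CTm Γ o} (h : Irred t) (ρ : Ren Γ Δ) :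
    Irred (ren ρ t) := by
  intro c hc
  obtain ⟨t', -, h'⟩ := exists_of_step_ren ρ t hc
  exact h _ h'

theorem not_isLam_of_isAtomic {Γ : Ctx ι} {A : Ty ι} (hA : A.IsAtomic) (t : CTm Γ (.ty A)) :
    ¬ IsLam t := by
  obtain ⟨i, rfl⟩ := hA
  cases t <;> exact id

theorem Irred.app {Γ : Ctx ι} {A B : Ty ι} {a : CTm Γ (.ty (.arrow A B))} {b : CTm Γ (.ty A)}
    (ha : Irred a) (hb : Irred b) (hl : ¬ IsLam a) : Irred (app a b) := by
  intro t h
  cases h with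
  | beta a b => exact hl trivial
  | appL _ h => exact ha _ h
  | appR _ h => exact hb _ h

theorem shift_ne_zero {Γ : Ctx ι} {A : Ty ι} (t : CTm Γ (.ty A)) :
    shift t ≠ var (.zero : Var (A :: Γ) A) := by
  intro h
  cases t <;> cases h

/-- A substituted term of atomic type is not an abstraction and a variable neither, so no β-redex
appears. A new η-redex would need `1` as the last argument, but weakened terms are never the bound
variable, and an old occurrence of `1` gives an η-redex in `t` by strengthening. -/
theorem irred_sub {Γ Δ : Ctx ι} {o : Obj ι} (t : CTm Γ o) (ht : Irred t) (τ : Env Γ Δ)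
    (hτ : ∀ B v, Irred (τ B v) ∧ (B.IsAtomic ∨ ∃ w, τ B v = var w)) : Irred (sub τ t) := by
  induction t generalizing Δ with
  | var v => exact (hτ _ v).1
  | mvar Θ A n s ih =>
    intro c hc
    cases hc with
    | mvar _ _ _ hc => exact ih (fun _ h => ht _ (.mvar _ _ _ h)) τ hτ _ hc
  | app a b iha ihb =>
    refine (iha (fun _ h => ht _ (.appL _ h)) τ hτ).app (ihb (fun _ h => ht _ (.appR _ h)) τ hτ) ?_
    cases a with
    | var v =>
      rcases (hτ _ v).2 with ⟨i, hi⟩ | ⟨w, hw⟩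
      · cases hi
      · rw [CTm.sub, hw]; exact id
    | lam a => exact (ht _ (.beta _ _)).elim
    | _ => exact id
  | @lam Γ A B a ih =>
    have h := ih (fun _ h => ht _ (.lam h)) (liftEnv τ A) fun C v => by
      cases v with
      | zero => exact ⟨irred_var _, .inr ⟨_, rfl⟩⟩
      | succ v =>
        refine ⟨(hτ C v).1.ren _, (hτ C v).2.imp_right ?_⟩
        rintro ⟨w, hw⟩
        exact ⟨.succ w, by simp only [liftEnv, consEnv, hw]; rfl⟩
    intro c hc
    simp only [CTm.sub] at hc
    generalize e : CTm.sub (liftEnv τ A) a = x at hc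
    cases hc with
    | lam hc => subst e; exact h _ hc
    | eta e' =>
      cases a with
      | var v =>
        cases v with
        | zero => cases e
        | succ v =>
          change shift (τ _ v) = _ at e
          generalize τ _ v = y at e
          cases y with
          | app p q =>
            simp only [shift, CTm.ren] at e
            generalize hy : CTm.ren Ren.succ q = y at e
            cases e
            exact shift_ne_zero _ hy
          | _ => cases e
      | app p q =>
        cases q with
        | var v =>
          cases v with
          | zero =>
            cases e
            obtain ⟨p', rfl, -⟩ := exists_shift_of_sub_liftEnv e'
            exact ht _ (.eta rfl)
          | succ v =>
            change CTm.app _ (shift (τ _ v)) = _ at e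
            generalize hy : shift (τ _ v) = y at e
            cases e
            exact shift_ne_zero _ hy
        | _ => cases e
      | _ => cases e
  | nil => exact nofun
  | cons a s iha ihs =>
    intro c hc
    cases hc with
    | consL _ hc => exact iha (fun _ h => ht _ (.consL _ h)) τ hτ _ hc
    | consR _ hc => exact ihs (fun _ h => ht _ (.consR _ h)) τ hτ _ hc

theorem _root_.Var.mem {Γ : Ctx ι} {A : Ty ι} (v : Var Γ A) : A ∈ Γ := by
  induction v with
  | zero => exact List.mem_cons_self
  | succ v ih => exact List.mem_cons_of_mem _ ih

/-- The grafted term is irreducible and of order at most `2`, unless the original one is an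
abstraction. -/
def GraftIrred (U : ∀ (Γ : Ctx ι) (A : Ty ι), ℕ → CTm Γ (.ty A)) {Γ : Ctx ι} {A : Ty ι}
    (t : CTm Γ (.ty A)) : Prop :=
  ¬ IsLam t → A.order ≤ 2 ∧ Irred (graft U t) ∧ ¬ IsLam (graft U t)

/-- The property `GraftIrred` for a term or for all components of a tuple. -/
def GraftIrredObj (U : ∀ (Γ : Ctx ι) (A : Ty ι), ℕ → CTm Γ (.ty A)) {Γ : Ctx ι} :
    ∀ {o : Obj ι}, CTm Γ o → Prop
  | .ty _, t => GraftIrred U t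
  | .cx _, s => ∀ B v, GraftIrred U (lookup s B v)

/-- The order bound is carried along the head of an application: it makes every argument atomic, so
the induction meets no abstraction and stays over `Γ`. An argument of a metavariable that is not
atomic is a variable, untouched by grafting. -/
theorem graftIrredObj (U : ∀ (Γ : Ctx ι) (A : Ty ι), ℕ → CTm Γ (.ty A))
    (hU : ∀ Γ A n, Irred (U Γ A n)) {Γ : Ctx ι} {o : Obj ι} (t : CTm Γ o)
    (hΓ : ∀ B ∈ Γ, B.order ≤ 2) (ht : Irred t) (hf : Flat (.zero : Depth Γ Γ) t) :
    GraftIrredObj U t := by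
  induction t with
  | var v => exact fun _ => ⟨hΓ _ v.mem, irred_var _, id⟩
  | mvar Δ A n s ih =>
    intro _
    obtain ⟨hA, hs, hf⟩ := hf
    refine ⟨?_, ?_, not_isLam_of_isAtomic hA _⟩
    · obtain ⟨i, rfl⟩ := hA
      exact one_le_two
    · refine irred_sub _ (hU _ _ _) _ fun B v => ?_
      rw [lookup_graft]
      rcases hs B v with hB | ⟨w, hw⟩
      · exact ⟨(ih hΓ (fun _ h => ht _ (.mvar _ _ _ h)) hf B v (not_isLam_of_isAtomic hB _)).2.1,
          .inl hB⟩
      · simp only [hw]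
        exact ⟨irred_var _, .inr ⟨_, rfl⟩⟩
  | app a b iha ihb =>
    intro _
    obtain ⟨h1, h2, h3⟩ := iha hΓ (fun _ h => ht _ (.appL _ h)) hf.1 (by
      cases a with
      | lam a => exact (ht _ (.beta _ _)).elim
      | _ => exact id)
    have h4 := (le_max_left _ _).trans h1
    have h5 := ihb hΓ (fun _ h => ht _ (.appR _ h)) hf.2
      (not_isLam_of_isAtomic (Ty.isAtomic_of_order_le_one (by omega)) _)
    exact ⟨(le_max_right _ _).trans h1, h2.app h5.2.1 h3, id⟩
  | lam a ih => exact fun h => (h trivial).elim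
  | nil => exact nofun
  | cons a s iha ihs =>
    intro B v
    cases v with
    | zero => exact iha hΓ (fun _ h => ht _ (.consL _ h)) hf.1
    | succ v => exact ihs hΓ (fun _ h => ht _ (.consR _ h)) hf.2 B v

end CTm

/-! ### From a λ-solution to a σ-solution. -/

namespace Exp

open CTm

variable {ι : Type u}

/-- The λ-terms `θ X` have irreducible bodies, which can be chosen as the values of the new
metavariables `Y`. -/
theorem exists_irred_bodies {Γ : Ctx ι} (ν : Ctx ι → Ty ι → ℕ → ℕ)
    {S : Set (Ctx ι × Ty ι × ℕ)} (hν : Set.InjOn (newMVar ν) S) (θ : ∀ A : Ty ι, ℕ → Lam Γ A) :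
    ∃ U : ∀ (Γ : Ctx ι) (A : Ty ι), ℕ → CTm Γ (.ty A), (∀ Δ B m, Irred (U Δ B m)) ∧
      ∀ A n, (Γ, A, n) ∈ S →
        Steps (lams A (body A (θ A n).embed)) (lams A (U (A.bodyCtx Γ) A.target (ν Γ A n))) := by
  -- The choice is made for an arbitrary sort and name, whereas the body has the sort computed from
  -- `A`; the heterogeneous equality bridges the two.
  have key : ∀ Δ B m, ∃ u : CTm Δ (.ty B), Irred u ∧ ∀ A n, (Γ, A, n) ∈ S →
      newMVar ν (Γ, A, n) = (Δ, B, m) → ∀ u' : CTm (A.bodyCtx Γ) (.ty A.target), HEq u u' →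
        Steps (lams A (body A (θ A n).embed)) (lams A u') := by
    intro Δ B m
    by_cases h : ∃ A n, (Γ, A, n) ∈ S ∧ newMVar ν (Γ, A, n) = (Δ, B, m)
    · obtain ⟨A, n, hS, e⟩ := h
      cases e
      obtain ⟨u, h1, h2⟩ := exists_irred (body A (θ A n).embed)
      refine ⟨u, h2, fun A' n' hS' e' u' hu => ?_⟩
      -- Different `X` have different `Y`, so the value chosen for `Y` has to serve a single `X`.
      have e := hν hS' hS e'
      cases e
      cases hu
      exact h1.lams A
    · exact ⟨_, irred_dummy B, fun A n hS e => (h ⟨A, n, hS, e⟩).elim⟩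
  choose U hU hU' using key
  exact ⟨U, hU, fun A n hS => hU' _ _ _ A n hS rfl _ HEq.rfl⟩

theorem hasSigmaSolution_of_hasSolution {Γ : Ctx ι} {A : Ty ι} {a b : Lam Γ A}
    (hab : Lam.IsSecondOrder a b) {ν : Ctx ι → Ty ι → ℕ → ℕ}
    (hν : IsNew ν (a.precook.mvars ∪ b.precook.mvars)) {a' b' : Exp (.tm Γ A)}
    (ha : a'.IsNormalFormOf (a.precook.expand ν)) (hb : b'.IsNormalFormOf (b.precook.expand ν))
    (h : Lam.HasSolution a b) : HasSigmaSolution a' b' := by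
  obtain ⟨θ, hθ⟩ := h
  obtain ⟨U, hU, hθU⟩ := exists_irred_bodies ν hν.1 θ
  have hX : ∀ X : Ty ι × ℕ, (Γ, X) ∈ a.precook.mvars ∪ b.precook.mvars →
      Join (θ X.1 X.2).embed (CTm.graft U (lamsMVar X.1 Γ (ν Γ X.1 X.2)).eval) := by
    intro X hX
    rw [graft_lamsMVar]
    -- The solution for `X` is an η-reduct of the abstraction of its body, and that body reduces to
    -- the chosen value of `Y`.
    exact Join.trans ⟨_, .refl, lams_body X.1 _⟩ ⟨_, hθU X.1 X.2 hX, .refl⟩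
  have irr : ∀ {c : Lam Γ A} {c' : Exp (.tm Γ A)}, c'.IsNormalFormOf (c.precook.expand ν) →
      (∀ X ∈ c.mvars, X.1.order ≤ 2) →
      (∀ X ∈ c.mvars, (Γ, X) ∈ a.precook.mvars ∪ b.precook.mvars) →
      Irred (CTm.graft U c'.eval) ∧ Join (Lam.inst θ c).embed (CTm.graft U c'.eval) := by
    intro c c' hc h2 hS
    have hs := hc.steps
    rw [Lam.eval_expand_precook] at hs
    have hf := hs.flat (flat_value ν .zero c h2)
    refine ⟨(graftIrredObj U hU c'.eval hab.ctx hc.eq_reify.2 hf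
      (not_isLam_of_isAtomic hab.atomic _)).2.1, ?_⟩
    exact (Lam.join_embed_instAt ν θ U .zero c fun X h => hX X (hS X h)).trans
      ⟨_, hs.graft U, .refl⟩
  obtain ⟨ia, ja⟩ := irr ha (fun X h => hab.mvars X (.inl h))
    fun X h => .inl (Lam.mem_mvars_precookAt .zero a h)
  obtain ⟨ib, jb⟩ := irr hb (fun X h => hab.mvars X (.inr h))
    fun X h => .inr (Lam.mem_mvars_precookAt .zero b h)
  -- The two grafted normal forms are βη-equal and irreducible, hence identical; so `σ` alone
  -- suffices.
  have e := ia.eq_of_join ib (ja.symm.trans (hθ.embed.trans jb))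
  refine ⟨fun Δ B n => reify (U Δ B n), sigmaConv_of_eval_eq ?_⟩
  have hr : (fun Δ B n => eval (reify (U Δ B n))) = U := by
    funext Δ B n; exact evalObj_reify (U Δ B n)
  rw [eval_graft, eval_graft, hr, e]

end Exp

theorem mainTheorem2 {ι : Type u} {Γ : Ctx ι} {A : Ty ι} (a b : Lam Γ A)
    (hab : Lam.IsSecondOrder a b) (ν : Ctx ι → Ty ι → ℕ → ℕ)
    (hν : Exp.IsNew ν (a.precook.mvars ∪ b.precook.mvars)) :
    (∃! a' : Exp (.tm Γ A), a'.IsNormalFormOf (a.precook.expand ν)) ∧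
    (∃! b' : Exp (.tm Γ A), b'.IsNormalFormOf (b.precook.expand ν)) ∧
    ∀ a' b' : Exp (.tm Γ A),
      a'.IsNormalFormOf (a.precook.expand ν) → b'.IsNormalFormOf (b.precook.expand ν) →
        (Lam.HasSolution a b ↔ Exp.HasSigmaSolution a' b') :=
  ⟨Exp.existsUnique_isNormalFormOf _, Exp.existsUnique_isNormalFormOf _, fun _ _ ha hb =>
    ⟨Exp.hasSigmaSolution_of_hasSolution hab hν ha hb,
      Exp.hasSolution_of_hasSigmaSolution ha hb⟩⟩
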